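/- Let $n\ge 2$ and let $\Delta_n\subset\mathbb{R}^{n+1}$ be the convex hull of the standard basis vectors $e_1,\dots,e_{n+1}$ (the regular $n$-simplex of side length $\sqrt2$), with center $c=\frac1{n+1}(1,\dots,1)$. A central hyperplane is an affine hyperplane of $\mathbb{R}^{n+1}$ that passes through $c$ and is different from the affine hull of $\Delta_n$. (Its intersection with that $n$-dimensional affine hull is then a hyperplane of the affine hull through $c$, and every such hyperplane arises in this way.) Let $H_{\mathrm{facet}}$ be any central hyperplane parallel to a facet of $\Delta_n$, that is, one whose direction space contains that of the facet. Let $\operatorname{vol}_{n-1}$ be $(n-1)$-dimensional Hausdorff measure, normalized to agree with Lebesgue measure on $\mathbb{R}^{n-1}$. Then for every central hyperplane $H$, $$\operatorname{vol}_{n-1}(H\cap\Delta_n)\ \ge\ \frac1e\sqrt{\frac{n+1}{n}}\left(\frac{n+1}{n}\right)^{n-1}\operatorname{vol}_{n-1}(H_{\mathrm{facet}}\cap\Delta_n)\ =\ \frac1e\,\frac{\sqrt{n+1}}{(n-1)!}.$$ Moreover $$\lim_{n\to\infty}\frac1e\sqrt{\frac{n+1}{n}}\left(\frac{n+1}{n}\right)^{n-1}=1,$$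 so the facet-parallel central section has minimal volume among all central sections up to a factor $1-o(1)$ as $n\to\infty$. -/

import Mathlib

open MeasureTheory Filter Topology

/-- The regular `n`-simplex of side length `√2`: the convex hull in `ℝⁿ⁺¹` of the standard basis
vectors `e₁, …, eₙ₊₁`. -/
def regularSimplex (n : ℕ) : Set (EuclideanSpace ℝ (Fin (n + 1))) :=
  convexHull ℝ (Set.range fun i => EuclideanSpace.single i (1 : ℝ))

/-- The facet of the regular simplex opposite the vertex `eᵢ`: the convex hull of the other
vertices. -/
def simplexFacet (n : ℕ) (i : Fin (n + 1)) : Set (EuclideanSpace ℝ (Fin (n + 1))) :=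
  convexHull ℝ ((fun j => EuclideanSpace.single j (1 : ℝ)) '' {j | j ≠ i})

/-- The center `(1/(n+1), …, 1/(n+1))` of the regular simplex. -/
noncomputable def simplexCenter (n : ℕ) : EuclideanSpace ℝ (Fin (n + 1)) :=
  WithLp.toLp 2 fun _ => 1 / ((n : ℝ) + 1)

/-- `H` is a hyperplane (affine subspace of codimension 1) of `ℝⁿ⁺¹` through the center of the
regular simplex, other than the affine hull of the simplex (whose intersection with the simplex
is the whole simplex and not a hyperplane section of it). The intersections of such `H` with the
affine hull of the simplex are exactly the hyperplanes through the center within that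
`n`-dimensional affine hull. -/
structure IsCentralHyperplane (n : ℕ)
    (H : AffineSubspace ℝ (EuclideanSpace ℝ (Fin (n + 1)))) : Prop where
  finrank_direction : Module.finrank ℝ H.direction = n
  center_mem : simplexCenter n ∈ H
  ne_affineSpan : H ≠ affineSpan ℝ (regularSimplex n)

/-- `F` is a central hyperplane that is parallel to a facet of the regular simplex, i.e. whose
direction contains the direction of the affine hull of a facet. -/
def IsFacetHyperplane (n : ℕ)
    (F : AffineSubspace ℝ (EuclideanSpace ℝ (Fin (n + 1)))) : Prop :=
  IsCentralHyperplane n F ∧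
    ∃ i, (affineSpan ℝ (simplexFacet n i)).direction ≤ F.direction

/-- The `(n-1)`-dimensional volume of the section `H ∩ Δₙ`. Here `μHE[d]` is the `d`-dimensional
Hausdorff measure, normalized to agree with Lebesgue measure on `d`-dimensional Euclidean space. -/
noncomputable def sectionVolume (n : ℕ)
    (H : AffineSubspace ℝ (EuclideanSpace ℝ (Fin (n + 1)))) : ℝ :=
  (μHE[n - 1] : Measure (EuclideanSpace ℝ (Fin (n + 1)))).real
    ((H : Set (EuclideanSpace ℝ (Fin (n + 1)))) ∩ regularSimplex n)

/-! Cut the simplex by a central hyperplane with unit normal a, ∑ a_j = 0, and let X_j be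
independent standard exponentials. Their joint density depends only on ∑ x_j on the positive
orthant, so slicing the hyperplane a·x = 0 by the levels of ∑ x_j shows that the density of ∑ a_j
X_j at 0 is (n-1)!/√(n+1) times the section volume (`sectionVolume_eq`). The same density is
computed explicitly for a facet normal, and the theorem becomes: a centered sum ∑ a_j X_j of
variance one has density at least 1/e at 0. The model case is X - 1, whose density at 0 is exactly
1/e; it is the limit of the facet normals.

By Fourier inversion (`integral_expWeight_hyperplane`) the density is (1/2π) ∫ M(it) dt with M(z) =
∏ (1 - a_j z)⁻¹. Move the contour to the curve z = x(y) + iy on which the arguments of the factors 1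
- a_j z sum to zero. There M is positive, so Im(M dz) = M dy and, by conjugation symmetry, the
density is (1/π) ∫ M dy over y > 0, without oscillation.

For X - 1 the transform is e^{-z}/(1 - z), the curve is x = 1 - y cot y with 0 < y < π, and the
value on it is exp(y cot y - 1) sin y / y = exp(`cotExponent` y). The heart of the proof,
`steepest_bound`, says that M is at least this value at equal height. With t = x/y and s_j = a_j y
the constraints are ∑ s_j = 0, ∑ s_j² = y² and ∑ Im `negLog` t s_j = 0, and ∑ Re `negLog` t s_j is
to be bounded below. A Lagrange multiplier inequality (`exists_negLog_re_ge`), tight at s = 0 and at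
the point η of the model curve with the same t, gives the bound (`cotExponent` η / η²) y²; since η ≤
y and `cotExponent` y / y² decreases, this is at least `cotExponent` y.

Finally ∫ exp(y cot y) sin y / y dy over (0, π) equals π, by the explicit primitive `cotPrimitive`.
Heights above π contribute a positive amount, and the density is at least (1/π)(π/e). -/

/-! ### The Lagrange multiplier inequality for one factor -/

/-- The logarithm `-log (1 - (t + i) s)`. -/
noncomputable def negLog (t s : ℝ) : ℂ := -Complex.log (1 - (t + Complex.I) * s)

lemma one_sub_mul_mem_slitPlane (t s : ℝ) : 1 - ((t : ℂ) + Complex.I) * s ∈ Complex.slitPlane := by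
  rw [Complex.mem_slitPlane_iff]
  by_cases h : s = 0
  · left; simp [h]
  · right; simpa using h

lemma quad_pos (t s : ℝ) : 0 < 1 - 2 * t * s + (1 + t ^ 2) * s ^ 2 := by
  by_cases h : s = 0
  · simp [h]
  · have : 0 < s ^ 2 := by positivity
    nlinarith [sq_nonneg (1 - t * s)]

lemma hasDerivAt_negLog (t s : ℝ) :
    HasDerivAt (negLog t)
      (((t - (1 + t ^ 2) * s : ℝ) + (1 : ℝ) * Complex.I) /
        (1 - 2 * t * s + (1 + t ^ 2) * s ^ 2 : ℝ)) s := by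
  have h1 : HasDerivAt (fun u : ℝ => 1 - ((t : ℂ) + Complex.I) * u) (-((t : ℂ) + Complex.I)) s := by
    simpa using (((hasDerivAt_id s).ofReal_comp.const_mul ((t : ℂ) + Complex.I)).const_sub 1)
  have h2 := (h1.clog_real (one_sub_mul_mem_slitPlane t s)).neg
  refine h2.congr_deriv ?_
  have hne := Complex.slitPlane_ne_zero (one_sub_mul_mem_slitPlane t s)
  have hD : ((1 - 2 * t * s + (1 + t ^ 2) * s ^ 2 : ℝ) : ℂ) ≠ 0 := by
    exact_mod_cast (quad_pos t s).ne'
  rw [neg_div, neg_neg, div_eq_div_iff hne hD]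
  push_cast
  linear_combination (s : ℂ) * Complex.I_sq

lemma hasDerivAt_negLog_re (t s : ℝ) :
    HasDerivAt (fun u => (negLog t u).re)
      ((t - (1 + t ^ 2) * s) / (1 - 2 * t * s + (1 + t ^ 2) * s ^ 2)) s := by
  refine (Complex.reCLM.hasFDerivAt.comp_hasDerivAt s (hasDerivAt_negLog t s)).congr_deriv ?_
  rw [Complex.reCLM_apply, Complex.div_ofReal_re]
  simp only [Complex.add_re, Complex.ofReal_re, Complex.re_ofReal_mul, Complex.I_re, mul_zero,
    add_zero]

lemma hasDerivAt_negLog_im (t s : ℝ) :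
    HasDerivAt (fun u => (negLog t u).im)
      (1 / (1 - 2 * t * s + (1 + t ^ 2) * s ^ 2)) s := by
  refine (Complex.imCLM.hasFDerivAt.comp_hasDerivAt s (hasDerivAt_negLog t s)).congr_deriv ?_
  rw [Complex.imCLM_apply, Complex.div_ofReal_im]
  simp only [Complex.add_im, Complex.ofReal_im, Complex.im_ofReal_mul, Complex.I_im, mul_one,
    zero_add]

@[simp] lemma negLog_zero (t : ℝ) : negLog t 0 = 0 := by simp [negLog]

lemma antitoneOn_of_hasDerivAt {g g' : ℝ → ℝ} {S : Set ℝ} (hS : Convex ℝ S)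
    (hg : ∀ s, HasDerivAt g (g' s) s) (h : ∀ s ∈ interior S, g' s ≤ 0) : AntitoneOn g S := by
  refine antitoneOn_of_deriv_nonpos hS (fun s _ => (hg s).continuousAt.continuousWithinAt)
    (fun s _ => (hg s).differentiableAt.differentiableWithinAt) fun s hs => ?_
  rw [(hg s).deriv]; exact h s hs

lemma monotoneOn_of_hasDerivAt {g g' : ℝ → ℝ} {S : Set ℝ} (hS : Convex ℝ S)
    (hg : ∀ s, HasDerivAt g (g' s) s) (h : ∀ s ∈ interior S, 0 ≤ g' s) : MonotoneOn g S := by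
  refine monotoneOn_of_deriv_nonneg hS (fun s _ => (hg s).continuousAt.continuousWithinAt)
    (fun s _ => (hg s).differentiableAt.differentiableWithinAt) fun s hs => ?_
  rw [(hg s).deriv]; exact h s hs

/-- Rolle between the two zeros 0 and η of g gives a second root ξ of the quadratic in (0, η). The
derivative then has the sign of s (s - ξ) (s - η), so g has its only local minima at 0 and η, where
it vanishes. -/
lemma nonneg_of_hasDerivAt_quadratic {g D : ℝ → ℝ} {A B C η : ℝ} (hD : ∀ s, 0 < D s)
    (hg : ∀ s, HasDerivAt g (s * (A * s ^ 2 + B * s + C) / D s) s) (hA : 0 < A) (hη : 0 < η)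
    (g0 : g 0 = 0) (gη : g η = 0) (hq : A * η ^ 2 + B * η + C = 0) (s : ℝ) : 0 ≤ g s := by
  obtain ⟨ξ, ⟨hξ0, hξη⟩, hξ⟩ := exists_hasDerivAt_eq_zero hη
    (fun s _ => (hg s).continuousAt.continuousWithinAt) (g0.trans gη.symm) (fun s _ => hg s)
  have hq' : A * ξ ^ 2 + B * ξ + C = 0 := by
    rcases (div_eq_zero_iff.1 hξ) with h | h
    · exact (mul_eq_zero.1 h).resolve_left hξ0.ne'
    · exact absurd h (hD ξ).ne'
  have hB : B = -A * (ξ + η) := by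
    have : (ξ - η) * (A * (ξ + η) + B) = 0 := by linear_combination hq' - hq
    rcases mul_eq_zero.1 this with h | h <;> linarith
  have hC : C = A * ξ * η := by rw [hB] at hq; linear_combination hq
  have hfac : ∀ s, s * (A * s ^ 2 + B * s + C) / D s = A * (s * (s - ξ) * (s - η)) / D s := by
    intro s; rw [hB, hC]; ring
  simp only [hfac] at hg
  have key : ∀ u, 0 ≤ u * (u - ξ) * (u - η) → 0 ≤ A * (u * (u - ξ) * (u - η)) / D u :=
    fun u hu => div_nonneg (mul_nonneg hA.le hu) (hD u).le
  have key' : ∀ u, u * (u - ξ) * (u - η) ≤ 0 → A * (u * (u - ξ) * (u - η)) / D u ≤ 0 :=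
    fun u hu => div_nonpos_of_nonpos_of_nonneg (mul_nonpos_of_nonneg_of_nonpos hA.le hu) (hD u).le
  rcases le_total s 0 with h0 | h0
  · have := antitoneOn_of_hasDerivAt (convex_Iic 0) hg (fun u hu => key' u (by
      rw [interior_Iic, Set.mem_Iio] at hu
      have h2 : 0 ≤ (ξ - u) * (η - u) := mul_nonneg (by linarith) (by linarith)
      nlinarith)) h0 (Set.mem_Iic.2 le_rfl) h0
    linarith
  rcases le_total s ξ with h1 | h1
  · have := monotoneOn_of_hasDerivAt (convex_Icc 0 ξ) hg (fun u hu => key u (by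
      rw [interior_Icc] at hu
      have h2 : 0 ≤ (ξ - u) * (η - u) := mul_nonneg (by linarith [hu.2]) (by linarith [hu.2])
      nlinarith [hu.1])) ⟨le_rfl, hξ0.le⟩ ⟨h0, h1⟩ h0
    linarith
  rcases le_total s η with h2 | h2
  · have := antitoneOn_of_hasDerivAt (convex_Icc ξ η) hg (fun u hu => key' u (by
      rw [interior_Icc] at hu
      have h2 : 0 ≤ u * (u - ξ) := mul_nonneg (by linarith [hu.1]) (by linarith [hu.1])
      nlinarith [hu.2])) ⟨h1, h2⟩ ⟨hξη.le, le_rfl⟩ h2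
    linarith
  · have := monotoneOn_of_hasDerivAt (convex_Ici η) hg (fun u hu => key u (by
      rw [interior_Ici, Set.mem_Ioi] at hu
      have h2 : 0 ≤ u * (u - ξ) := mul_nonneg (by linarith) (by linarith)
      nlinarith)) (Set.mem_Ici.2 le_rfl) h2 h2
    linarith

lemma hasDerivAt_negLog_im_sub (t s : ℝ) :
    HasDerivAt (fun u => (negLog t u).im - u)
      (s * (2 * t - (1 + t ^ 2) * s) / (1 - 2 * t * s + (1 + t ^ 2) * s ^ 2)) s := by
  refine ((hasDerivAt_negLog_im t s).sub (hasDerivAt_id s)).congr_deriv ?_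
  have := (quad_pos t s).ne'
  rw [eq_div_iff this, sub_mul, div_mul_cancel₀ _ this]
  ring

/-- The argument of `1 / (1 - (t + i) s)` agrees with `s` at some `s ∈ (0, π)`. -/
lemma exists_negLog_im_eq {t : ℝ} (ht : 0 < t) :
    ∃ η ∈ Set.Ioo 0 Real.pi, (negLog t η).im = η := by
  have hξ : 0 < 2 * t / (1 + t ^ 2) := by positivity
  set ξ := 2 * t / (1 + t ^ 2) with hξdef
  have hξ' : (1 + t ^ 2) * ξ = 2 * t := by rw [hξdef]; field_simp
  have hcont : Continuous fun u => (negLog t u).im - u :=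
    continuous_iff_continuousAt.2 fun s => (hasDerivAt_negLog_im_sub t s).continuousAt
  have hlt : ∀ s, (negLog t s).im ≤ Real.pi := fun s => by
    rw [negLog, Complex.neg_im, Complex.log_im]
    linarith [Complex.neg_pi_lt_arg (1 - ((t : ℂ) + Complex.I) * s)]
  have hpi : (negLog t Real.pi).im < Real.pi := by
    rw [negLog, Complex.neg_im, Complex.log_im]
    linarith [Complex.neg_pi_lt_arg (1 - ((t : ℂ) + Complex.I) * Real.pi)]
  have hpos : 0 < (negLog t ξ).im - ξ := by
    have hmono : StrictMonoOn (fun u => (negLog t u).im - u) (Set.Icc 0 ξ) := by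
      refine strictMonoOn_of_deriv_pos (convex_Icc 0 ξ) hcont.continuousOn fun s hs => ?_
      rw [interior_Icc] at hs
      rw [(hasDerivAt_negLog_im_sub t s).deriv]
      refine div_pos (mul_pos hs.1 ?_) (quad_pos t s)
      nlinarith [hs.2]
    simpa using hmono ⟨le_rfl, hξ.le⟩ ⟨hξ.le, le_rfl⟩ hξ
  -- At ξ the imaginary part exceeds ξ, while it never exceeds π.
  have hξpi : ξ < Real.pi := by
    have := hlt ξ; linarith
  obtain ⟨η, hη, h⟩ := intermediate_value_Icc' hξpi.le hcont.continuousOn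
    (show (0 : ℝ) ∈ Set.Icc ((negLog t Real.pi).im - Real.pi) ((negLog t ξ).im - ξ) from
      ⟨by linarith, hpos.le⟩)
  simp only at h
  refine ⟨η, ⟨hξ.trans_le hη.1, lt_of_le_of_ne hη.2 ?_⟩, by linarith⟩
  rintro rfl
  linarith

/-- The derivative of Im `negLog` t s - s changes sign only at 0 and at one point ξ in (0, η). The
difference therefore falls to 0 at s = 0, rises up to ξ and falls back to 0 at η. -/
lemma lt_negLog_im {t η s : ℝ} (hη : 0 < η) (h : (negLog t η).im = η) (hs : s < η) (hs0 : s ≠ 0) :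
    s < (negLog t s).im := by
  obtain ⟨ξ, ⟨hξ0, hξη⟩, hξ⟩ := exists_hasDerivAt_eq_zero hη
    (fun s _ => (hasDerivAt_negLog_im_sub t s).continuousAt.continuousWithinAt)
    (by simp [h]) (fun s _ => hasDerivAt_negLog_im_sub t s)
  have hξ' : (1 + t ^ 2) * ξ = 2 * t := by
    rcases (div_eq_zero_iff.1 hξ) with h | h
    · linarith [(mul_eq_zero.1 h).resolve_left hξ0.ne']
    · exact absurd h (quad_pos t ξ).ne'
  have hcont : Continuous fun u => (negLog t u).im - u :=
    continuous_iff_continuousAt.2 fun s => (hasDerivAt_negLog_im_sub t s).continuousAt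
  have ht : 0 < 1 + t ^ 2 := by positivity
  rcases lt_or_gt_of_ne hs0 with h0 | h0
  · have : StrictAntiOn (fun u => (negLog t u).im - u) (Set.Iic 0) := by
      refine strictAntiOn_of_deriv_neg (convex_Iic 0) hcont.continuousOn fun s hs => ?_
      rw [interior_Iic, Set.mem_Iio] at hs
      rw [(hasDerivAt_negLog_im_sub t s).deriv]
      refine div_neg_of_neg_of_pos (mul_neg_of_neg_of_pos hs ?_) (quad_pos t s)
      nlinarith
    have := this (Set.mem_Iic.2 h0.le) (Set.mem_Iic.2 le_rfl) h0
    simp only [negLog_zero, Complex.zero_im] at this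
    linarith
  rcases le_total s ξ with h1 | h1
  · have : StrictMonoOn (fun u => (negLog t u).im - u) (Set.Icc 0 ξ) := by
      refine strictMonoOn_of_deriv_pos (convex_Icc 0 ξ) hcont.continuousOn fun s hs => ?_
      rw [interior_Icc] at hs
      rw [(hasDerivAt_negLog_im_sub t s).deriv]
      refine div_pos (mul_pos hs.1 ?_) (quad_pos t s)
      nlinarith [hs.2]
    have := this ⟨le_rfl, hξ0.le⟩ ⟨h0.le, h1⟩ h0
    simp only [negLog_zero, Complex.zero_im] at this
    linarith
  · have : StrictAntiOn (fun u => (negLog t u).im - u) (Set.Icc ξ η) := by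
      refine strictAntiOn_of_deriv_neg (convex_Icc ξ η) hcont.continuousOn fun s hs => ?_
      rw [interior_Icc] at hs
      rw [(hasDerivAt_negLog_im_sub t s).deriv]
      refine div_neg_of_neg_of_pos (mul_neg_of_pos_of_neg (hξ0.trans hs.1) ?_) (quad_pos t s)
      nlinarith [hs.1]
    have := this ⟨h1, hs.le⟩ ⟨hξη.le, le_rfl⟩ hs
    simp only [h] at this
    linarith

/-- Supporting inequality for `-log |1 - (t + i) s|`, with equality at `s = 0` and `s = η`. -/
lemma exists_negLog_re_ge {t η ν : ℝ} (hη : 0 < η) (h : (negLog t η).im = η)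
    (hν : ν * η ^ 2 = (negLog t η).re - t * η) (hν0 : ν < 0) :
    ∃ l : ℝ, ∀ s, ν * s ^ 2 ≤ (negLog t s).re - t * s + l * ((negLog t s).im - s) := by
  obtain ⟨ξ, ⟨hξ0, hξη⟩, hξ⟩ := exists_hasDerivAt_eq_zero hη
    (fun s _ => (hasDerivAt_negLog_im_sub t s).continuousAt.continuousWithinAt)
    (by simp [h]) (fun s _ => hasDerivAt_negLog_im_sub t s)
  have hξ' : (1 + t ^ 2) * ξ = 2 * t := by
    rcases (div_eq_zero_iff.1 hξ) with h | h
    · linarith [(mul_eq_zero.1 h).resolve_left hξ0.ne']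
    · exact absurd h (quad_pos t ξ).ne'
  have ht : 0 < 1 + t ^ 2 := by positivity
  -- The left side is (1 + t²)(ξ - η), and ξ < η.
  have hne : 2 * t - (1 + t ^ 2) * η ≠ 0 := by nlinarith
  -- The multiplier is the one for which the difference of the two sides has zero derivative at η;
  -- its value there is zero by the choice of ν.
  set l := -(-2 * ν * (1 - 2 * t * η + (1 + t ^ 2) * η ^ 2) + (-(1 + t ^ 2) + 2 * t ^ 2)
    - t * (1 + t ^ 2) * η) / (2 * t - (1 + t ^ 2) * η) with hl
  have hl' : l * (2 * t - (1 + t ^ 2) * η) = -(-2 * ν * (1 - 2 * t * η + (1 + t ^ 2) * η ^ 2) +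
    (-(1 + t ^ 2) + 2 * t ^ 2) - t * (1 + t ^ 2) * η) := by
    rw [hl, div_mul_cancel₀ _ hne]
  refine ⟨l, fun s => ?_⟩
  have hD := quad_pos t
  have hder : ∀ s, HasDerivAt
      (fun s => (negLog t s).re - t * s + l * ((negLog t s).im - s) - ν * s ^ 2)
      (s * (-2 * ν * (1 + t ^ 2) * s ^ 2 + (4 * ν * t - t * (1 + t ^ 2) - l * (1 + t ^ 2)) * s
        + (-2 * ν + (-(1 + t ^ 2) + 2 * t ^ 2) + 2 * l * t)) /
        (1 - 2 * t * s + (1 + t ^ 2) * s ^ 2)) s := by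
    intro s
    refine ((((hasDerivAt_negLog_re t s).sub ((hasDerivAt_id s).const_mul t)).add
      ((hasDerivAt_negLog_im_sub t s).const_mul l)).sub
      (((hasDerivAt_id s).pow 2).const_mul ν)).congr_deriv ?_
    have := (hD s).ne'
    obtain ⟨D, hDs⟩ : ∃ D, D = 1 - 2 * t * s + (1 + t ^ 2) * s ^ 2 := ⟨_, rfl⟩
    rw [← hDs] at this ⊢
    simp only [id]
    field_simp
    rw [hDs]
    ring
  -- The leading coefficient -2ν(1 + t²) is positive because ν < 0.
  have := nonneg_of_hasDerivAt_quadratic hD hder (by nlinarith) hη (by simp)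
    (by rw [h]; linarith) (by linear_combination hl') s
  linarith

/-! ### The exponent of the model variable X - 1 -/

/-- The exponent `y cot y - 1 + log (sin y / y)`. -/
noncomputable def cotExponent (y : ℝ) : ℝ :=
  y * (Real.cos y / Real.sin y) - 1 + Real.log (Real.sin y / y)

lemma mul_cos_div_sin_lt_one {y : ℝ} (hy : y ∈ Set.Ioo 0 Real.pi) :
    y * (Real.cos y / Real.sin y) < 1 := by
  have hs := Real.sin_pos_of_mem_Ioo hy
  rw [← mul_div_assoc, div_lt_one hs]
  rcases lt_or_ge y (Real.pi / 2) with h | h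
  · have hc : 0 < Real.cos y := Real.cos_pos_of_mem_Ioo ⟨by linarith [hy.1, Real.pi_pos], h⟩
    have := Real.lt_tan hy.1 h
    rwa [Real.tan_eq_sin_div_cos, lt_div_iff₀ hc] at this
  · have hc : Real.cos y ≤ 0 :=
      Real.cos_nonpos_of_pi_div_two_le_of_le h (by linarith [hy.2, Real.pi_pos])
    nlinarith [hy.1]

lemma cotExponent_neg {y : ℝ} (hy : y ∈ Set.Ioo 0 Real.pi) : cotExponent y < 0 := by
  have h1 := mul_cos_div_sin_lt_one hy
  have hs := Real.sin_pos_of_mem_Ioo hy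
  have : Real.log (Real.sin y / y) ≤ 0 := by
    refine Real.log_nonpos (div_pos hs hy.1).le ((div_le_one hy.1).2 (Real.sin_lt hy.1).le)
  unfold cotExponent; linarith

lemma hasDerivAt_cotExponent {y : ℝ} (hy : y ∈ Set.Ioo 0 Real.pi) :
    HasDerivAt cotExponent
      (2 * (Real.cos y / Real.sin y) - y / Real.sin y ^ 2 - 1 / y) y := by
  have hs := Real.sin_pos_of_mem_Ioo hy
  have h1 := ((hasDerivAt_id y).mul ((Real.hasDerivAt_cos y).div (Real.hasDerivAt_sin y) hs.ne'))
  have h2 := ((Real.hasDerivAt_sin y).div (hasDerivAt_id y) hy.1.ne').log (div_pos hs hy.1).ne'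
  refine ((h1.sub_const 1).add h2).congr_deriv ?_
  have := hy.1.ne'
  simp only [id, Pi.div_apply]
  field_simp
  linear_combination (- y ^ 2) * (Real.sin_sq_add_cos_sq y)

/-- With u = (y / sin y)², the derivative has the sign of log u - (u - 1), which is nonpositive. -/
lemma cotExponent_div_sq_antitoneOn :
    AntitoneOn (fun y => cotExponent y / y ^ 2) (Set.Ioo 0 Real.pi) := by
  have hd : ∀ y ∈ Set.Ioo 0 Real.pi, HasDerivAt (fun y => cotExponent y / y ^ 2) _ y :=
    fun y hy => (hasDerivAt_cotExponent hy).div ((hasDerivAt_id y).pow 2)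
      (pow_ne_zero 2 hy.1.ne')
  refine antitoneOn_of_deriv_nonpos (convex_Ioo _ _)
    (fun y hy => (hd y hy).continuousAt.continuousWithinAt)
    (fun y hy => (hd y (interior_subset hy)).differentiableAt.differentiableWithinAt)
    fun y hy => ?_
  rw [interior_Ioo] at hy
  rw [(hd y hy).deriv]
  have hs := Real.sin_pos_of_mem_Ioo hy
  refine div_nonpos_of_nonpos_of_nonneg ?_ (by positivity)
  have hy0 := hy.1
  have hq : Real.log ((y / Real.sin y) ^ 2) ≤ (y / Real.sin y) ^ 2 - 1 :=
    Real.log_le_sub_one_of_pos (by positivity)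
  rw [Real.log_pow, show y / Real.sin y = (Real.sin y / y)⁻¹ by rw [inv_div], Real.log_inv,
    inv_div] at hq
  have h2 : y * (2 * (Real.cos y / Real.sin y) - y / Real.sin y ^ 2 - 1 / y)
      = 2 * (y * (Real.cos y / Real.sin y)) - (y / Real.sin y) ^ 2 - 1 := by
    field_simp
  have h3 : y * (2 * (Real.cos y / Real.sin y) - y / Real.sin y ^ 2 - 1 / y)
      - 2 * cotExponent y ≤ 0 := by
    rw [h2]; unfold cotExponent; push_cast at hq; linarith
  simp only [id]
  have := mul_nonpos_of_nonneg_of_nonpos hy0.le h3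
  push_cast
  linarith

/-- The derivative of `cotExponent` y + y²/2 is minus the square (sin y - y cos y)² over y sin² y,
and near 0 the function is at most y²/2. This serves the case x = 0, where t = 0 and the model point
η is unavailable. -/
lemma cotExponent_le_neg_sq_div_two {y : ℝ} (hy : y ∈ Set.Ioo 0 Real.pi) :
    cotExponent y ≤ -y ^ 2 / 2 := by
  have hd : ∀ y ∈ Set.Ioo 0 Real.pi, HasDerivAt (fun y => cotExponent y + y ^ 2 / 2) _ y :=
    fun y hy => (hasDerivAt_cotExponent hy).add (((hasDerivAt_id y).pow 2).div_const 2)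
  have hanti : AntitoneOn (fun y => cotExponent y + y ^ 2 / 2) (Set.Ioo 0 Real.pi) := by
    refine antitoneOn_of_deriv_nonpos (convex_Ioo _ _)
      (fun y hy => (hd y hy).continuousAt.continuousWithinAt)
      (fun y hy => (hd y (interior_subset hy)).differentiableAt.differentiableWithinAt)
      fun y hy => ?_
    rw [interior_Ioo] at hy
    rw [(hd y hy).deriv]
    have hs := Real.sin_pos_of_mem_Ioo hy
    have hy0 := hy.1
    have : 2 * (Real.cos y / Real.sin y) - y / Real.sin y ^ 2 - 1 / y + y =
        -(Real.sin y - y * Real.cos y) ^ 2 / (y * Real.sin y ^ 2) := by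
      field_simp
      linear_combination (y ^ 2) * (Real.sin_sq_add_cos_sq y)
    simp only [id]
    have h2 : -(Real.sin y - y * Real.cos y) ^ 2 / (y * Real.sin y ^ 2) ≤ 0 :=
      div_nonpos_of_nonpos_of_nonneg (by nlinarith [sq_nonneg (Real.sin y - y * Real.cos y)])
        (by positivity)
    rw [← this] at h2
    push_cast
    linarith
  have hle : ∀ ε ∈ Set.Ioo 0 y, cotExponent y + y ^ 2 / 2 ≤ ε ^ 2 / 2 := by
    intro ε hε
    have hε' : ε ∈ Set.Ioo 0 Real.pi := ⟨hε.1, hε.2.trans hy.2⟩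
    have := hanti hε' hy hε.2.le
    simp only at this
    linarith [cotExponent_neg hε']
  have hlim : Tendsto (fun ε : ℝ => ε ^ 2 / 2) (𝓝[>] 0) (𝓝 0) := by
    have : Continuous fun ε : ℝ => ε ^ 2 / 2 := by fun_prop
    simpa using (this.tendsto 0).mono_left nhdsWithin_le_nhds
  have := ge_of_tendsto hlim (Filter.mem_of_superset (Ioo_mem_nhdsGT hy.1) hle)
  linarith

/-- Polar form of 1 - (t + i)η with argument -η: the modulus must be η / sin η. Hence Re `negLog` t
η - tη = `cotExponent` η, the value on the model curve. -/
lemma negLog_apply_of_im_eq {t η : ℝ} (hη : η ∈ Set.Ioo 0 Real.pi) (h : (negLog t η).im = η) :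
    (negLog t η).re = Real.log (Real.sin η / η) ∧ t * η = 1 - η * (Real.cos η / Real.sin η) := by
  have hs := Real.sin_pos_of_mem_Ioo hη
  have h1 : 1 - ((t : ℂ) + Complex.I) * η = Complex.exp (-(negLog t η)) := by
    rw [negLog, neg_neg, Complex.exp_log (Complex.slitPlane_ne_zero
      (one_sub_mul_mem_slitPlane t η))]
  have hre := congrArg Complex.re h1
  have him := congrArg Complex.im h1
  rw [Complex.exp_re] at hre
  rw [Complex.exp_im] at him
  simp [h] at hre him
  have hexp : Real.exp (-(negLog t η).re) = η / Real.sin η := by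
    rw [eq_div_iff hs.ne']; linarith
  constructor
  · have := congrArg Real.log hexp
    rw [Real.log_exp] at this
    rw [← inv_div, Real.log_inv]; linarith
  · rw [hexp] at hre
    rw [show η * (Real.cos η / Real.sin η) = η / Real.sin η * Real.cos η by ring]; linarith

lemma negLog_div_mul {x y : ℝ} (hy : y ≠ 0) (a : ℝ) :
    negLog (x / y) (a * y) = -Complex.log (1 - a * (x + y * Complex.I)) := by
  have : (y : ℂ) ≠ 0 := by exact_mod_cast hy
  rw [negLog]
  congr 3
  push_cast
  field_simp

/-! ### The pointwise lower bound on the contour -/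

section
variable {ι : Type*} [Fintype ι] {a : ι → ℝ}

lemma abs_le_one_of_sum_sq (ha : ∑ j, a j ^ 2 = 1) (j : ι) : |a j| ≤ 1 := by
  rw [← sq_le_one_iff_abs_le_one, ← ha]
  exact Finset.single_le_sum (f := fun j => a j ^ 2) (fun i _ => sq_nonneg _) (Finset.mem_univ j)

lemma one_sub_mul_ne_zero {x y : ℝ} (hy : y ≠ 0) (b : ℝ) :
    1 - (b : ℂ) * (x + y * Complex.I) ≠ 0 := by
  intro h
  have him := congrArg Complex.im h
  have hre := congrArg Complex.re h
  simp [hy] at him hre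
  simp [him] at hre

lemma prod_inv_norm_eq_exp {x y : ℝ} (hy : y ≠ 0) :
    ∏ j, ‖1 - (a j : ℂ) * (x + y * Complex.I)‖⁻¹ =
      Real.exp (∑ j, (negLog (x / y) (a j * y)).re) := by
  rw [Real.exp_sum]
  refine Finset.prod_congr rfl fun j _ => ?_
  rw [negLog_div_mul hy, Complex.neg_re, Complex.log_re, Real.exp_neg, Real.exp_log]
  exact norm_pos_iff.2 (one_sub_mul_ne_zero hy _)

lemma steepest_bound_of_nonneg (ha0 : ∑ j, a j = 0) (ha1 : ∑ j, a j ^ 2 = 1) {x y : ℝ}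
    (hx : 0 ≤ x) (hy : y ∈ Set.Ioo 0 Real.pi)
    (harg : ∑ j, (1 - (a j : ℂ) * (x + y * Complex.I)).arg = 0) :
    Real.exp (cotExponent y) ≤ ∏ j, ‖1 - (a j : ℂ) * (x + y * Complex.I)‖⁻¹ ∧
      (y ≤ 1 → x ≤ y ^ 2 / 2) := by
  have hy0 := hy.1
  have him : ∑ j, (negLog (x / y) (a j * y)).im = 0 := by
    rw [← neg_eq_zero, ← Finset.sum_neg_distrib, ← harg]
    refine Finset.sum_congr rfl fun j _ => ?_
    rw [negLog_div_mul hy0.ne', Complex.neg_im, neg_neg, Complex.log_im]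
  have hs0 : ∑ j, a j * y = 0 := by rw [← Finset.sum_mul, ha0, zero_mul]
  have hs1 : ∑ j, (a j * y) ^ 2 = y ^ 2 := by
    simp only [mul_pow]; rw [← Finset.sum_mul, ha1, one_mul]
  rw [prod_inv_norm_eq_exp hy0.ne', Real.exp_le_exp]
  rcases hx.eq_or_lt with rfl | hx
  -- For x = 0 each factor has modulus √(1 + s_j²), and log (1 + s²) ≤ s² suffices.
  · refine ⟨(cotExponent_le_neg_sq_div_two hy).trans ?_, fun _ => by positivity⟩
    rw [← hs1, neg_div, Finset.sum_div, ← Finset.sum_neg_distrib]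
    refine Finset.sum_le_sum fun j _ => ?_
    have hn : 0 < ‖1 - ((0 : ℂ) + Complex.I) * (a j * y : ℝ)‖ :=
      norm_pos_iff.2 (by
        simpa using Complex.slitPlane_ne_zero (one_sub_mul_mem_slitPlane 0 (a j * y)))
    have hsq : ‖1 - ((0 : ℂ) + Complex.I) * (a j * y : ℝ)‖ ^ 2 = 1 + (a j * y) ^ 2 := by
      rw [← Complex.normSq_eq_norm_sq, Complex.normSq_apply]
      simp; ring
    have hlog := Real.log_le_sub_one_of_pos (pow_pos hn 2)
    rw [Real.log_pow, hsq] at hlog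
    rw [zero_div, negLog, Complex.neg_re, Complex.log_re, Complex.ofReal_zero]
    push_cast at hlog ⊢
    linarith
  · set t := x / y with ht
    have ht0 : 0 < t := div_pos hx hy0
    obtain ⟨η, hη, hηim⟩ := exists_negLog_im_eq ht0
    obtain ⟨hre, htη⟩ := negLog_apply_of_im_eq hη hηim
    -- If y < η, every s_j = a_j y lies below η, so Im `negLog` t s_j ≥ s_j with strictness for some
    -- j. Both sides sum to zero, a contradiction.
    have hηy : η ≤ y := by
      by_contra! hlt
      have hne : ∃ j, a j ≠ 0 := by
        by_contra! hall
        simp [hall] at ha1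
      obtain ⟨j, hj⟩ := hne
      have hle : ∀ i, a i * y ≤ y := fun i => by
        have := (abs_le.1 (abs_le_one_of_sum_sq ha1 i)).2
        nlinarith
      have : ∑ i, a i * y < ∑ i, (negLog t (a i * y)).im := by
        refine Finset.sum_lt_sum (fun i _ => ?_) ⟨j, Finset.mem_univ j, ?_⟩
        · by_cases hi : a i = 0
          · simp [hi]
          · exact (lt_negLog_im hη.1 hηim ((hle i).trans_lt hlt)
              (mul_ne_zero hi hy0.ne')).le
        · exact lt_negLog_im hη.1 hηim ((hle j).trans_lt hlt) (mul_ne_zero hj hy0.ne')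
      rw [hs0, him] at this
      exact lt_irrefl _ this
    have hη2 : 0 < η ^ 2 := pow_pos hη.1 2
    set ν := cotExponent η / η ^ 2 with hν
    have hν' : ν * η ^ 2 = (negLog t η).re - t * η := by
      rw [hν, div_mul_cancel₀ _ hη2.ne', hre, htη, cotExponent]; ring
    obtain ⟨l, hl⟩ := exists_negLog_re_ge hη.1 hηim hν'
      (div_neg_of_neg_of_pos (cotExponent_neg hη) hη2)
    constructor
    · have h1 : cotExponent y ≤ ν * y ^ 2 := by
        have := cotExponent_div_sq_antitoneOn hη hy hηy
        simp only at this
        rwa [div_le_iff₀ (pow_pos hy0 2)] at this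
      refine h1.trans ?_
      -- On summation the linear term and the multiplier term vanish by the constraints.
      have h2 := Finset.sum_le_sum fun j (_ : j ∈ Finset.univ) => hl (a j * y)
      simp only [Finset.sum_add_distrib, Finset.sum_sub_distrib, ← Finset.mul_sum] at h2
      rw [hs0, hs1, him] at h2
      linarith
    · intro hy1
      have hη1 : η ≤ 1 := hηy.trans hy1
      have hs := Real.sin_pos_of_mem_Ioo hη
      have hc := Real.one_sub_sq_div_two_le_cos (x := η)
      have hc' : Real.cos η ≤ η * (Real.cos η / Real.sin η) := by
        rw [← mul_div_assoc, le_div_iff₀ hs, mul_comm]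
        exact mul_le_mul_of_nonneg_right (Real.sin_le hη.1.le) (by nlinarith [hη.1])
      -- tη = 1 - η cot η ≤ 1 - cos η ≤ η²/2.
      have h3 : t * η ≤ η / 2 * η := by nlinarith
      have h4 : t ≤ η / 2 := le_of_mul_le_mul_right h3 hη.1
      have h5 : x = t * y := by rw [ht, div_mul_cancel₀ _ hy0.ne']
      rw [h5]
      nlinarith

/-- Lower bound for `∏ |1 - a_j z|⁻¹` along the curve where `∏ (1 - a_j z)` is positive, together
with a bound for the real part on that curve. -/
lemma steepest_bound (ha0 : ∑ j, a j = 0) (ha1 : ∑ j, a j ^ 2 = 1) {x y : ℝ}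
    (hy : y ∈ Set.Ioo 0 Real.pi)
    (harg : ∑ j, (1 - (a j : ℂ) * (x + y * Complex.I)).arg = 0) :
    Real.exp (cotExponent y) ≤ ∏ j, ‖1 - (a j : ℂ) * (x + y * Complex.I)‖⁻¹ ∧
      (y ≤ 1 → |x| ≤ y ^ 2 / 2) := by
  rcases le_total 0 x with hx | hx
  · rw [abs_of_nonneg hx]
    exact steepest_bound_of_nonneg ha0 ha1 hx hy harg
  -- Replacing a by -a and z by minus its conjugate conjugates every factor and changes the sign of
  -- x.
  · have hconj : ∀ j, 1 - ((-a j : ℝ) : ℂ) * ((-x : ℝ) + y * Complex.I) =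
        (starRingEnd ℂ) (1 - (a j : ℂ) * (x + y * Complex.I)) := by
      intro j
      apply Complex.ext
      · simp; ring
      · simp
    have hslit : ∀ j, (1 - (a j : ℂ) * (x + y * Complex.I)).arg ≠ Real.pi := by
      intro j
      have := one_sub_mul_mem_slitPlane (x / y) (a j * y)
      rw [show 1 - (((x / y : ℝ) : ℂ) + Complex.I) * (a j * y : ℝ) =
        1 - (a j : ℂ) * (x + y * Complex.I) by
          have : (y : ℂ) ≠ 0 := by exact_mod_cast hy.1.ne'
          push_cast; field_simp] at this
      exact (Complex.mem_slitPlane_iff_arg.1 this).1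
    have := steepest_bound_of_nonneg (a := fun j => -a j) (x := -x)
      (by rw [Finset.sum_neg_distrib, ha0, neg_zero]) (by simpa using ha1) (by linarith) hy (by
        simp only [hconj, Complex.arg_conj, hslit, if_false, Finset.sum_neg_distrib, harg,
          neg_zero])
    simp only [hconj, RCLike.norm_conj] at this
    rwa [abs_of_nonpos hx]
end

/-! ### Holomorphic primitives and the integral of the model profile -/

/-- The primitive `z ↦ ∫₀¹ z F(r z) dr` of a holomorphic function on a domain that is star-shaped
about the origin. -/
noncomputable def radialPrimitive (F : ℂ → ℂ) (z : ℂ) : ℂ := ∫ r in (0 : ℝ)..1, z * F (r * z)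

/-- Differentiation under the integral sign: the w-derivative of w F(rw) equals the r-derivative of
r F(rw), so the integral telescopes to F(z). -/
lemma hasDerivAt_radialPrimitive {F : ℂ → ℂ} {U : Set ℂ} (hU : IsOpen U)
    (hstar : ∀ z ∈ U, ∀ r ∈ Set.Icc (0 : ℝ) 1, (r : ℂ) * z ∈ U) (hF : DifferentiableOn ℂ F U)
    {z : ℂ} (hz : z ∈ U) : HasDerivAt (radialPrimitive F) (F z) z := by
  have hF' := hF.deriv hU
  obtain ⟨ε, hε, hball⟩ := Metric.nhds_basis_closedBall.mem_iff.1 (hU.mem_nhds hz)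
  have hmaps : ∀ w ∈ U, Set.MapsTo (fun r : ℝ => (r : ℂ) * w) (Set.uIcc 0 1) U := by
    intro w hw r hr
    rw [Set.uIcc_of_le zero_le_one] at hr
    exact hstar w hw r hr
  have hc : ∀ w ∈ U, ∀ {f : ℂ → ℂ}, DifferentiableOn ℂ f U →
      ContinuousOn (fun r : ℝ => f (r * w)) (Set.uIcc 0 1) := fun w hw f hf =>
    hf.continuousOn.comp (by fun_prop) (hmaps w hw)
  have hder : ∀ w ∈ U, ∀ r ∈ Set.Icc (0 : ℝ) 1,
      HasDerivAt (fun w : ℂ => w * F (r * w)) (F (r * w) + w * (deriv F (r * w) * r)) w := by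
    intro w hw r hr
    have h1 : HasDerivAt F (deriv F (r * w)) (r * w) :=
      ((hF _ (hstar w hw r hr)).differentiableAt (hU.mem_nhds (hstar w hw r hr))).hasDerivAt
    have h2 := h1.comp w ((hasDerivAt_id w).const_mul (r : ℂ))
    refine ((hasDerivAt_id w).mul h2).congr_deriv ?_
    simp
  have hder' : ∀ w ∈ U, ∀ r ∈ Set.Icc (0 : ℝ) 1,
      HasDerivAt (fun r : ℝ => r * F (r * w)) (F (r * w) + w * (deriv F (r * w) * r)) r := by
    intro w hw r hr
    have h1 : HasDerivAt F (deriv F (r * w)) (r * w) :=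
      ((hF _ (hstar w hw r hr)).differentiableAt (hU.mem_nhds (hstar w hw r hr))).hasDerivAt
    have h2 : HasDerivAt (fun r : ℝ => (r : ℂ) * w) w r := by
      simpa using ((hasDerivAt_id r).ofReal_comp.mul_const w)
    have h3 := (hasDerivAt_id r).ofReal_comp.mul (h1.comp r h2)
    refine h3.congr_deriv ?_
    simp
    ring
  have hcont' : ∀ w ∈ U, ContinuousOn
      (fun r : ℝ => F (r * w) + w * (deriv F (r * w) * r)) (Set.uIcc 0 1) := fun w hw =>
    (hc w hw hF).add (continuousOn_const.mul ((hc w hw hF').mul (by fun_prop)))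
  have hK : IsCompact (Set.Icc (0 : ℝ) 1 ×ˢ Metric.closedBall z ε) :=
    isCompact_Icc.prod (isCompact_closedBall z ε)
  have hbig : ContinuousOn (fun p : ℝ × ℂ => F (p.1 * p.2) + p.2 * (deriv F (p.1 * p.2) * p.1))
      (Set.Icc (0 : ℝ) 1 ×ˢ Metric.closedBall z ε) := by
    have hm : Set.MapsTo (fun p : ℝ × ℂ => (p.1 : ℂ) * p.2)
        (Set.Icc (0 : ℝ) 1 ×ˢ Metric.closedBall z ε) U :=
      fun p hp => hstar _ (hball hp.2) _ hp.1
    have h0 : ContinuousOn (fun p : ℝ × ℂ => (p.1 : ℂ) * p.2)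
        (Set.Icc (0 : ℝ) 1 ×ˢ Metric.closedBall z ε) := by fun_prop
    exact (hF.continuousOn.comp h0 hm).add (continuousOn_snd.mul
      ((hF'.continuousOn.comp h0 hm).mul (by fun_prop)))
  obtain ⟨C, hC⟩ := hK.exists_bound_of_continuousOn hbig
  have key := intervalIntegral.hasDerivAt_integral_of_dominated_loc_of_deriv_le
    (μ := volume) (a := 0) (b := 1) (bound := fun _ => C)
    (F := fun (w : ℂ) (r : ℝ) => w * F (r * w))
    (F' := fun (w : ℂ) (r : ℝ) => F (r * w) + w * (deriv F (r * w) * r))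
    (Metric.closedBall_mem_nhds z hε)
    (by
      filter_upwards [hU.mem_nhds hz] with w hw
      refine ContinuousOn.aestronglyMeasurable ?_ measurableSet_uIoc
      exact (continuousOn_const.mul (hc w hw hF)).mono Set.uIoc_subset_uIcc)
    ((continuousOn_const.mul (hc z hz hF)).intervalIntegrable)
    (((hcont' z hz).mono Set.uIoc_subset_uIcc).aestronglyMeasurable measurableSet_uIoc)
    (by
      refine Eventually.of_forall fun r hr w hw => ?_
      rw [Set.uIoc_of_le zero_le_one] at hr
      exact hC (r, w) ⟨⟨hr.1.le, hr.2⟩, hw⟩)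
    intervalIntegrable_const
    (by
      refine Eventually.of_forall fun r hr w hw => ?_
      rw [Set.uIoc_of_le zero_le_one] at hr
      exact hder w (hball hw) r ⟨hr.1.le, hr.2⟩)
  refine key.2.congr_deriv ?_
  rw [intervalIntegral.integral_eq_sub_of_hasDerivAt
    (f := fun r : ℝ => (r : ℂ) * F (r * z)) (fun r hr => hder' z hz r (by
      rwa [Set.uIcc_of_le zero_le_one] at hr)) (hcont' z hz).intervalIntegrable]
  simp

/-- The entire function `(exp w - 1) / w`. -/
noncomputable def expSlope : ℂ → ℂ := dslope Complex.exp 0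

lemma differentiable_expSlope : Differentiable ℂ expSlope := by
  rw [← differentiableOn_univ]
  exact (Complex.differentiableOn_dslope univ_mem).2 Complex.differentiable_exp.differentiableOn

lemma mul_expSlope (w : ℂ) : w * expSlope w = Complex.exp w - 1 := by
  simpa [expSlope] using sub_smul_dslope Complex.exp 0 w

lemma hasDerivAt_expPrimitive (w : ℂ) :
    HasDerivAt (radialPrimitive expSlope) (expSlope w) w :=
  hasDerivAt_radialPrimitive isOpen_univ (fun _ _ _ _ => Set.mem_univ _)
    differentiable_expSlope.differentiableOn (Set.mem_univ w)

/-- The imaginary part of the integrand, times r, is exp(r Re w) sin(r Im w). The factor r cancels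
against |sin(r Im w)| ≤ r |Im w|. -/
lemma abs_im_expPrimitive_le (w : ℂ) :
    |(radialPrimitive expSlope w).im| ≤ |w.im| * ∫ r in (0 : ℝ)..1, Real.exp (r * w.re) := by
  have hcont : Continuous fun r : ℝ => w * expSlope (r * w) :=
    continuous_const.mul (differentiable_expSlope.continuous.comp (by fun_prop))
  have h1 : (radialPrimitive expSlope w).im =
      ∫ r in (0 : ℝ)..1, (w * expSlope (r * w)).im :=
    (Complex.imCLM.intervalIntegral_comp_comm (hcont.intervalIntegrable 0 1)).symm
  rw [h1, ← intervalIntegral.integral_const_mul, ← Real.norm_eq_abs]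
  refine intervalIntegral.norm_integral_le_of_norm_le zero_le_one
    (Eventually.of_forall fun r hr => ?_) (by
      exact Continuous.intervalIntegrable (by fun_prop) _ _)
  have hr0 := hr.1
  have h2 : (r : ℂ) * (w * expSlope (r * w)) = Complex.exp (r * w) - 1 := by
    rw [← mul_expSlope]; ring
  have h3 := congrArg Complex.im h2
  rw [Complex.im_ofReal_mul, Complex.sub_im, Complex.exp_im, Complex.one_im, sub_zero,
    Complex.re_ofReal_mul, Complex.im_ofReal_mul] at h3
  have h4 : r * |(w * expSlope (r * w)).im| ≤ r * (|w.im| * Real.exp (r * w.re)) := by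
    rw [← abs_of_pos hr0, ← abs_mul, abs_of_pos hr0, h3, abs_mul, abs_of_pos (Real.exp_pos _)]
    have : |Real.sin (r * w.im)| ≤ r * |w.im| := by
      rw [← abs_of_pos hr0, ← abs_mul, abs_of_pos hr0]; exact Real.abs_sin_le_abs
    nlinarith [Real.exp_pos (r * w.re)]
  exact le_of_mul_le_mul_left h4 hr0

/-- A primitive of `exp (1 + cotExponent y) = exp (y cot y) sin y / y`. -/
noncomputable def cotPrimitive (y : ℝ) : ℝ :=
  y + (radialPrimitive expSlope
    ((y * (Real.cos y / Real.sin y) : ℝ) + y * Complex.I)).im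

lemma exp_cotExponent {y : ℝ} (hy : y ∈ Set.Ioo 0 Real.pi) :
    Real.exp (cotExponent y) = Real.exp (y * (Real.cos y / Real.sin y)) * (Real.sin y / y) /
      Real.exp 1 := by
  rw [cotExponent, Real.exp_add, Real.exp_sub,
    Real.exp_log (div_pos (Real.sin_pos_of_mem_Ioo hy) hy.1)]
  ring

/-- Along w = y cot y + iy one has w = (y / sin y) e^{iy}, so e^w = G w with G = exp(y cot y) sin y
/ y real. Thus (e^w - 1)/w = G - 1/w, and since Im w' = Im(w'/w) = 1 the imaginary part of the
primitive grows at rate G - 1; the summand y restores the missing 1. -/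
lemma hasDerivAt_cotPrimitive {y : ℝ} (hy : y ∈ Set.Ioo 0 Real.pi) :
    HasDerivAt cotPrimitive (Real.exp (y * (Real.cos y / Real.sin y)) * (Real.sin y / y)) y := by
  have hs := Real.sin_pos_of_mem_Ioo hy
  have hy0 := hy.1
  set c := Real.cos y / Real.sin y with hc
  set w : ℂ := (y * c : ℝ) + y * Complex.I with hw
  have hw' : HasDerivAt (fun y : ℝ => ((y * (Real.cos y / Real.sin y) : ℝ) : ℂ) + y * Complex.I)
      ((c - y * (1 + c ^ 2) : ℝ) + Complex.I) y := by
    have h1 : HasDerivAt (fun y => y * (Real.cos y / Real.sin y)) (c - y * (1 + c ^ 2)) y := by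
      refine ((hasDerivAt_id y).mul
        ((Real.hasDerivAt_cos y).div (Real.hasDerivAt_sin y) hs.ne')).congr_deriv ?_
      simp only [id, Pi.div_apply, hc]
      field_simp
      ring
    refine (h1.ofReal_comp.add ((hasDerivAt_id y).ofReal_comp.mul_const Complex.I)).congr_deriv ?_
    simp
  have h2 := (hasDerivAt_expPrimitive w).comp y hw'
  have h3 := (hasDerivAt_id y).add (Complex.imCLM.hasFDerivAt.comp_hasDerivAt y h2)
  refine h3.congr_deriv ?_
  have hwne : w ≠ 0 := by
    intro h
    have := congrArg Complex.im h
    simp [hw] at this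
    exact hy0.ne' this
  have hyC : (y : ℂ) ≠ 0 := by exact_mod_cast hy0.ne'
  have hsC : ((Real.sin y : ℝ) : ℂ) ≠ 0 := by exact_mod_cast hs.ne'
  have hww : w = (y / Real.sin y : ℝ) * (Real.cos y + Real.sin y * Complex.I) := by
    rw [hw, hc]; push_cast at hsC ⊢; field_simp
  have hexp : Complex.exp w = Real.exp (y * c) * (Real.cos y + Real.sin y * Complex.I) := by
    rw [hw, Complex.exp_add, Complex.exp_mul_I, Complex.ofReal_exp]; push_cast; ring
  have hexp' : Complex.exp w = (Real.exp (y * c) * (Real.sin y / y) : ℝ) * w := by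
    rw [hexp, hww]; push_cast at hsC ⊢; field_simp
  have hquot : ((c - y * (1 + c ^ 2) : ℝ) : ℂ) + Complex.I = ((1 / y - c : ℝ) + Complex.I) * w := by
    rw [hw]; push_cast; field_simp
    linear_combination (-(y : ℂ)) * Complex.I_sq
  have hslope : expSlope w * ((c - y * (1 + c ^ 2) : ℝ) + Complex.I) =
      (Real.exp (y * c) * (Real.sin y / y) : ℝ) * ((c - y * (1 + c ^ 2) : ℝ) + Complex.I) -
        ((1 / y - c : ℝ) + Complex.I) := by
    have : expSlope w = (Real.exp (y * c) * (Real.sin y / y) : ℝ) - 1 / w := by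
      have := mul_expSlope w
      rw [hexp'] at this
      refine mul_left_cancel₀ hwne ?_
      rw [this, mul_sub, mul_one_div_cancel hwne, mul_comm]
    rw [this, sub_mul]
    congr 1
    rw [hquot]; field_simp
  rw [Complex.imCLM_apply, hslope, Complex.sub_im, Complex.im_ofReal_mul, Complex.add_im,
    Complex.add_im, Complex.ofReal_im, Complex.ofReal_im, Complex.I_im]
  ring

lemma tendsto_cotPrimitive_zero : Tendsto cotPrimitive (𝓝[>] 0) (𝓝 0) := by
  have h0 : Tendsto (fun y : ℝ => y * (1 + Real.exp 1)) (𝓝[>] 0) (𝓝 0) := by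
    have : Continuous fun y : ℝ => y * (1 + Real.exp 1) := by fun_prop
    simpa using (this.tendsto 0).mono_left nhdsWithin_le_nhds
  refine squeeze_zero_norm' ?_ h0
  filter_upwards [Ioo_mem_nhdsGT Real.pi_pos] with y hy
  rw [Real.norm_eq_abs, cotPrimitive]
  have h1 := abs_im_expPrimitive_le ((y * (Real.cos y / Real.sin y) : ℝ) + y * Complex.I)
  have h2 : ∫ r in (0 : ℝ)..1, Real.exp (r * (y * (Real.cos y / Real.sin y))) ≤ Real.exp 1 := by
    have : ∫ r in (0 : ℝ)..1, Real.exp (r * (y * (Real.cos y / Real.sin y))) ≤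
        ∫ r in (0 : ℝ)..1, Real.exp 1 := by
      refine intervalIntegral.integral_mono_on zero_le_one
        (Continuous.intervalIntegrable (by fun_prop) _ _) intervalIntegrable_const fun r hr => ?_
      rw [Real.exp_le_exp]
      nlinarith [mul_cos_div_sin_lt_one hy, hr.1, hr.2]
    simpa using this
  simp only [Complex.add_im, Complex.ofReal_im, Complex.im_ofReal_mul, Complex.I_im, Complex.add_re,
    Complex.ofReal_re, Complex.re_ofReal_mul, Complex.I_re, mul_zero, mul_one, add_zero,
    zero_add, abs_of_pos hy.1] at h1
  refine (abs_add_le _ _).trans ?_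
  rw [abs_of_pos hy.1]
  have := mul_le_mul_of_nonneg_left h2 hy.1.le
  linarith

lemma tendsto_mul_cos_div_sin :
    Tendsto (fun y => y * (Real.cos y / Real.sin y)) (𝓝[<] Real.pi) atBot := by
  have h1 : Tendsto (fun y => y * Real.cos y) (𝓝[<] Real.pi) (𝓝 (-Real.pi)) := by
    have : Continuous fun y => y * Real.cos y := by fun_prop
    simpa using (this.tendsto Real.pi).mono_left (nhdsWithin_le_nhds (s := Set.Iio Real.pi))
  have h2 : Tendsto (fun y => (Real.sin y)⁻¹) (𝓝[<] Real.pi) atTop := by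
    refine tendsto_inv_nhdsGT_zero.comp (tendsto_nhdsWithin_iff.2 ⟨?_, ?_⟩)
    · simpa using (Real.continuous_sin.tendsto Real.pi).mono_left
        (nhdsWithin_le_nhds (s := Set.Iio Real.pi))
    · filter_upwards [Ioo_mem_nhdsLT Real.pi_pos] with y hy
      exact Real.sin_pos_of_mem_Ioo hy
  refine (h1.neg_mul_atTop (by linarith [Real.pi_pos]) h2).congr fun y => ?_
  ring

/-- As y → π the real part y cot y tends to -∞, so the integral of exp(r Re w) over [0, 1] is at
most 1/|Re w| and only the summand y survives. With the limit 0 at the origin, the profile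
integrates to π. -/
lemma tendsto_cotPrimitive_pi : Tendsto cotPrimitive (𝓝[<] Real.pi) (𝓝 Real.pi) := by
  have hid : Tendsto (fun y : ℝ => y) (𝓝[<] Real.pi) (𝓝 Real.pi) := nhdsWithin_le_nhds
  have hb : Tendsto (fun y => Real.pi * (-(y * (Real.cos y / Real.sin y)))⁻¹) (𝓝[<] Real.pi)
      (𝓝 0) := by
    simpa using (tendsto_inv_atTop_zero.comp
      (tendsto_neg_atBot_atTop.comp tendsto_mul_cos_div_sin)).const_mul Real.pi
  have him : Tendsto (fun y : ℝ => (radialPrimitive expSlope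
      ((y * (Real.cos y / Real.sin y) : ℝ) + y * Complex.I)).im) (𝓝[<] Real.pi) (𝓝 0) := by
    refine squeeze_zero_norm' ?_ hb
    filter_upwards [Ioo_mem_nhdsLT Real.pi_pos, tendsto_mul_cos_div_sin.eventually_lt_atBot 0]
      with y hy hneg
    have h1 := abs_im_expPrimitive_le ((y * (Real.cos y / Real.sin y) : ℝ) + y * Complex.I)
    simp only [Complex.add_im, Complex.ofReal_im, Complex.im_ofReal_mul, Complex.I_im,
      Complex.add_re, Complex.ofReal_re, Complex.re_ofReal_mul, Complex.I_re, mul_zero, mul_one,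
      add_zero, zero_add, abs_of_pos hy.1] at h1
    rw [Real.norm_eq_abs]
    refine h1.trans (mul_le_mul hy.2.le ?_ ?_ Real.pi_pos.le)
    · rw [intervalIntegral.integral_comp_mul_right (fun u => Real.exp u) hneg.ne, integral_exp,
        one_mul, zero_mul, Real.exp_zero, smul_eq_mul, inv_neg]
      nlinarith [inv_lt_zero.2 hneg, Real.exp_pos (y * (Real.cos y / Real.sin y))]
    · exact intervalIntegral.integral_nonneg zero_le_one fun r _ => (Real.exp_pos _).le
  have := hid.add him
  rwa [add_zero] at this

/-! ### The moment generating function and its decay -/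

section
variable {ι : Type*}

/-- The star-shaped domain on which all `1 - a_j z` avoid the negative real axis. -/
def slitDomain (a : ι → ℝ) : Set ℂ := {z | ∀ j, 1 - (a j : ℂ) * z ∈ Complex.slitPlane}

variable {a : ι → ℝ}

lemma zero_mem_slitDomain : (0 : ℂ) ∈ slitDomain a := fun j => by simp

lemma mul_mem_slitDomain (z : ℂ) (hz : z ∈ slitDomain a) (r : ℝ) (hr : r ∈ Set.Icc (0 : ℝ) 1) :
    (r : ℂ) * z ∈ slitDomain a := by
  intro j
  have := Complex.starConvex_one_slitPlane (hz j) (sub_nonneg.2 hr.2) hr.1 (by ring)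
  convert this using 1
  simp only [Complex.real_smul]
  push_cast; ring

lemma mem_slitPlane_of_im_pos {x y : ℝ} (hy : 0 < y) (b : ℝ) :
    1 - (b : ℂ) * (x + y * Complex.I) ∈ Complex.slitPlane := by
  have := one_sub_mul_mem_slitPlane (x / y) (b * y)
  rwa [show 1 - (((x / y : ℝ) : ℂ) + Complex.I) * (b * y : ℝ) =
    1 - (b : ℂ) * (x + y * Complex.I) by
      have : (y : ℂ) ≠ 0 := by exact_mod_cast hy.ne'
      push_cast; field_simp] at this

lemma mem_slitDomain_of_im_pos {x y : ℝ} (hy : 0 < y) : (x + y * Complex.I : ℂ) ∈ slitDomain a :=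
  fun j => mem_slitPlane_of_im_pos hy (a j)

variable [Fintype ι]

/-- The moment generating function `∏ (1 - a_j z)⁻¹` of `∑ a_j X_j` for independent standard
exponential variables `X_j`. -/
noncomputable def expMgf (a : ι → ℝ) (z : ℂ) : ℂ := ∏ j, (1 - (a j : ℂ) * z)⁻¹

lemma isOpen_slitDomain : IsOpen (slitDomain a) := by
  have : slitDomain a = ⋂ j, (fun z : ℂ => 1 - (a j : ℂ) * z) ⁻¹' Complex.slitPlane := by
    ext z; simp [slitDomain]
  rw [this]
  exact isOpen_iInter_of_finite fun j => Complex.isOpen_slitPlane.preimage (by fun_prop)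

lemma differentiableOn_expMgf : DifferentiableOn ℂ (expMgf a) (slitDomain a) := by
  intro z hz
  unfold expMgf
  refine DifferentiableWithinAt.fun_finsetProd fun j _ => ?_
  exact DifferentiableWithinAt.inv (by fun_prop) (Complex.slitPlane_ne_zero (hz j))

lemma hasDerivAt_expMgfPrimitive {z : ℂ} (hz : z ∈ slitDomain a) :
    HasDerivAt (radialPrimitive (expMgf a)) (expMgf a z) z :=
  hasDerivAt_radialPrimitive isOpen_slitDomain mul_mem_slitDomain differentiableOn_expMgf hz

lemma exists_pos_and_neg (ha0 : ∑ j, a j = 0) (ha1 : ∑ j, a j ^ 2 = 1) :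
    (∃ p, 0 < a p) ∧ ∃ q, a q < 0 := by
  have hne : ∃ j, a j ≠ 0 := by
    by_contra! hall
    simp [hall] at ha1
  obtain ⟨j, hj⟩ := hne
  constructor
  · by_contra! hall
    have := Finset.sum_lt_sum (fun i (_ : i ∈ Finset.univ) => hall i)
      ⟨j, Finset.mem_univ j, lt_of_le_of_ne (hall j) hj⟩
    simp [ha0] at this
  · by_contra! hall
    have := Finset.sum_lt_sum (fun i (_ : i ∈ Finset.univ) => hall i)
      ⟨j, Finset.mem_univ j, lt_of_le_of_ne (hall j) hj.symm⟩
    simp [ha0] at this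

/-- One positive and one negative coefficient supply two factors of order 1/|z|; the other factors
are at most 1 far out. -/
lemma exists_norm_expMgf_le (ha0 : ∑ j, a j = 0) (ha1 : ∑ j, a j ^ 2 = 1) :
    ∃ c R : ℝ, 0 ≤ c ∧ 0 < R ∧ ∀ z : ℂ, R ≤ ‖z‖ → ‖expMgf a z‖ ≤ c / ‖z‖ ^ 2 := by
  classical
  obtain ⟨⟨p, hp⟩, q, hq⟩ := exists_pos_and_neg ha0 ha1
  have hpq : p ≠ q := by rintro rfl; linarith
  -- This radius makes |a_j z| ≥ 2 whenever a_j ≠ 0; zero coefficients add nothing to it because 2 /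
  -- 0 = 0.
  refine ⟨4 / (|a p| * |a q|), 1 + ∑ j, 2 / |a j|, by positivity, by positivity, fun z hz => ?_⟩
  have hz0 : 0 < ‖z‖ := lt_of_lt_of_le (by positivity) hz
  have hbig : ∀ j, a j ≠ 0 → 2 ≤ |a j| * ‖z‖ := by
    intro j hj
    have h1 : 2 / |a j| ≤ ‖z‖ := by
      have := Finset.single_le_sum (f := fun j => 2 / |a j|) (fun i _ => by positivity)
        (Finset.mem_univ j)
      linarith
    rwa [div_le_iff₀ (abs_pos.2 hj), mul_comm] at h1
  have hnorm : ∀ j, |a j| * ‖z‖ - 1 ≤ ‖1 - (a j : ℂ) * z‖ := by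
    intro j
    have := norm_sub_norm_le ((a j : ℂ) * z) 1
    rw [norm_sub_rev] at this
    simpa using this
  have hle : ∀ j, ‖(1 - (a j : ℂ) * z)⁻¹‖ ≤
      (if j = p then 2 / (|a p| * ‖z‖) else 1) * (if j = q then 2 / (|a q| * ‖z‖) else 1) := by
    intro j
    rw [norm_inv]
    have hsmall : a j ≠ 0 → ‖1 - (a j : ℂ) * z‖⁻¹ ≤ 2 / (|a j| * ‖z‖) := by
      intro hj
      rw [← inv_div]
      refine inv_anti₀ (by positivity) ?_
      linarith [hnorm j, hbig j hj]
    by_cases h1 : j = p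
    · subst h1; simpa [hpq] using hsmall hp.ne'
    by_cases h2 : j = q
    · subst h2; simpa [h1] using hsmall hq.ne
    · simp only [h1, h2, if_false, mul_one]
      by_cases hj : a j = 0
      · simp [hj]
      · exact inv_le_one_of_one_le₀ (by linarith [hnorm j, hbig j hj])
  calc ‖expMgf a z‖ = ∏ j, ‖(1 - (a j : ℂ) * z)⁻¹‖ := norm_prod _ _
    _ ≤ _ := Finset.prod_le_prod (fun _ _ => norm_nonneg _) fun j _ => hle j
    _ = _ := by
      rw [Finset.prod_mul_distrib]
      simp only [Finset.prod_ite_eq', Finset.mem_univ, if_true]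
      have := hp.ne'
      have := hq.ne
      field_simp
      norm_num

/-! ### The contour of steepest descent -/

/-- The sum of the arguments of the factors `1 - a_j (x + i y)`. -/
noncomputable def argSum (a : ι → ℝ) (p : ℝ × ℝ) : ℝ :=
  ∑ j, (1 - (a j : ℂ) * (p.2 + p.1 * Complex.I)).arg

lemma contDiffAt_argSum {p : ℝ × ℝ} (hp : 0 < p.1) : ContDiffAt ℝ 1 (argSum a) p := by
  unfold argSum
  simp only [← Complex.log_im]
  refine ContDiffAt.sum fun j _ => ?_
  have h1 : ContDiffAt ℝ 1 (fun p : ℝ × ℝ => 1 - (a j : ℂ) * (p.2 + p.1 * Complex.I)) p := by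
    have h2 : ContDiff ℝ 1 fun p : ℝ × ℝ => (p.2 : ℂ) := Complex.ofRealCLM.contDiff.comp contDiff_snd
    have h3 : ContDiff ℝ 1 fun p : ℝ × ℝ => (p.1 : ℂ) := Complex.ofRealCLM.contDiff.comp contDiff_fst
    exact (contDiff_const.sub (contDiff_const.mul (h2.add (h3.mul contDiff_const)))).contDiffAt
  have h2 := ((Complex.contDiffAt_log (n := 1) (mem_slitPlane_of_im_pos (x := p.2) hp (a j))).restrict_scalars
    ℝ).comp p h1
  exact Complex.imCLM.contDiff.contDiffAt.comp p h2

lemma hasDerivAt_argSum {x y : ℝ} (hy : 0 < y) :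
    HasDerivAt (fun x => argSum a (y, x))
      (-∑ j, a j ^ 2 * y / ‖1 - (a j : ℂ) * (x + y * Complex.I)‖ ^ 2) x := by
  rw [← Finset.sum_neg_distrib]
  unfold argSum
  simp only [← Complex.log_im]
  refine HasDerivAt.fun_sum fun j _ => ?_
  have h1 : HasDerivAt (fun x : ℝ => 1 - (a j : ℂ) * (x + y * Complex.I)) (-(a j : ℂ)) x := by
    simpa using ((((hasDerivAt_id x).ofReal_comp).add_const (y * Complex.I)).const_mul
      (a j : ℂ)).const_sub 1
  have h2 := Complex.imCLM.hasFDerivAt.comp_hasDerivAt x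
    (h1.clog_real (mem_slitPlane_of_im_pos hy (a j)))
  refine h2.congr_deriv ?_
  rw [Complex.imCLM_apply, ← Complex.normSq_eq_norm_sq, Complex.div_im]
  simp
  ring

lemma deriv_argSum_neg (ha1 : ∑ j, a j ^ 2 = 1) {x y : ℝ} (hy : 0 < y) :
    -∑ j, a j ^ 2 * y / ‖1 - (a j : ℂ) * (x + y * Complex.I)‖ ^ 2 < 0 := by
  have hne : ∃ j, a j ≠ 0 := by
    by_contra! hall
    simp [hall] at ha1
  obtain ⟨j, hj⟩ := hne
  rw [neg_lt_zero]
  refine Finset.sum_pos' (fun i _ => by positivity) ⟨j, Finset.mem_univ j, ?_⟩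
  have := norm_pos_iff.2 (one_sub_mul_ne_zero (x := x) hy.ne' (a j))
  have := sq_pos_of_ne_zero hj
  positivity

lemma strictAnti_argSum (ha1 : ∑ j, a j ^ 2 = 1) {y : ℝ} (hy : 0 < y) :
    StrictAnti fun x => argSum a (y, x) :=
  strictAnti_of_hasDerivAt_neg (fun _ => hasDerivAt_argSum hy) fun _ => deriv_argSum_neg ha1 hy

/-- Dividing by x > 0 keeps the argument and moves the point to -b. For b > 0 this limit lies on the
branch cut and is approached from below, whence -π. -/
lemma tendsto_arg_one_sub_mul (b : ℝ) {y : ℝ} (hy : 0 < y) :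
    Tendsto (fun x : ℝ => (1 - (b : ℂ) * (x + y * Complex.I)).arg) atTop
      (𝓝 (if 0 < b then -Real.pi else 0)) := by
  have hscale : (fun x : ℝ => (1 - (b : ℂ) * (x + y * Complex.I)).arg) =ᶠ[atTop]
      fun x : ℝ => ((x⁻¹ : ℝ) * (1 - (b : ℂ) * (x + y * Complex.I))).arg := by
    filter_upwards [eventually_gt_atTop 0] with x hx
    rw [Complex.arg_real_mul _ (inv_pos.2 hx)]
  have hlim : Tendsto (fun x : ℝ => ((x⁻¹ : ℝ) : ℂ) * (1 - (b : ℂ) * (x + y * Complex.I))) atTop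
      (𝓝 (-b : ℂ)) := by
    have h0 : Tendsto (fun x : ℝ => ((x⁻¹ : ℝ) : ℂ)) atTop (𝓝 0) := by
      exact_mod_cast (Complex.continuous_ofReal.tendsto 0).comp tendsto_inv_atTop_zero
    have h1 : Tendsto (fun x : ℝ => ((x⁻¹ : ℝ) : ℂ) * (1 - b * (y * Complex.I)) - b) atTop
        (𝓝 (-b : ℂ)) := by
      simpa using (h0.mul_const (1 - (b : ℂ) * (y * Complex.I))).sub_const (b : ℂ)
    refine h1.congr' ?_
    filter_upwards [eventually_gt_atTop 0] with x hx
    have : (x : ℂ) ≠ 0 := by exact_mod_cast hx.ne'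
    push_cast
    field_simp
    ring
  rcases lt_trichotomy b 0 with hb | rfl | hb
  · rw [if_neg hb.not_gt]
    refine Tendsto.congr' hscale.symm ?_
    have hs : (-b : ℂ) ∈ Complex.slitPlane := by
      rw [Complex.mem_slitPlane_iff]; left; simpa using hb
    have := (Complex.continuousAt_arg hs).tendsto.comp hlim
    rwa [show (-b : ℂ).arg = 0 by
      rw [← Complex.ofReal_neg]; exact Complex.arg_ofReal_of_nonneg (by linarith)] at this
  · simp
  · rw [if_pos hb]
    refine Tendsto.congr' hscale.symm ?_
    refine (Complex.tendsto_arg_nhdsWithin_im_neg_of_re_neg_of_im_zero (z := (-b : ℂ))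
      (by simpa using hb) (by simp)).comp (tendsto_nhdsWithin_iff.2 ⟨hlim, ?_⟩)
    filter_upwards [eventually_gt_atTop 0] with x hx
    have : 0 < x⁻¹ * (b * y) := by positivity
    simp
    simpa using this

lemma exists_argSum_neg (ha0 : ∑ j, a j = 0) (ha1 : ∑ j, a j ^ 2 = 1) {y : ℝ} (hy : 0 < y) :
    ∃ x, argSum a (y, x) < 0 := by
  obtain ⟨⟨p, hp⟩, -⟩ := exists_pos_and_neg ha0 ha1
  have hlim : Tendsto (fun x => argSum a (y, x)) atTop
      (𝓝 (∑ j, if 0 < a j then -Real.pi else 0)) :=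
    tendsto_finsetSum _ fun j _ => tendsto_arg_one_sub_mul (a j) hy
  have hneg : (∑ j, if 0 < a j then -Real.pi else 0) < 0 := by
    refine Finset.sum_neg' (fun j _ => ?_) ⟨p, Finset.mem_univ p, ?_⟩
    · split_ifs <;> linarith [Real.pi_pos]
    · simp [hp, Real.pi_pos]
  exact (hlim.eventually_lt_const hneg).exists

lemma argSum_neg {x y : ℝ} (hy : 0 < y) :
    argSum (fun j => -a j) (y, -x) = -argSum a (y, x) := by
  unfold argSum
  rw [← Finset.sum_neg_distrib]
  refine Finset.sum_congr rfl fun j _ => ?_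
  have hconj : 1 - ((-a j : ℝ) : ℂ) * ((-x : ℝ) + y * Complex.I) =
      (starRingEnd ℂ) (1 - (a j : ℂ) * (x + y * Complex.I)) := by
    apply Complex.ext
    · simp; ring
    · simp
  rw [hconj, Complex.arg_conj, if_neg]
  exact (Complex.mem_slitPlane_iff_arg.1 (mem_slitPlane_of_im_pos hy (a j))).1

/-- The sum of arguments is negative far to the right and, by the reflection `argSum_neg`, positive
somewhere on the left. -/
lemma exists_argSum_eq_zero (ha0 : ∑ j, a j = 0) (ha1 : ∑ j, a j ^ 2 = 1) {y : ℝ} (hy : 0 < y) :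
    ∃ x, argSum a (y, x) = 0 := by
  obtain ⟨x₁, h₁⟩ := exists_argSum_neg ha0 ha1 hy
  obtain ⟨x₂, h₂⟩ := exists_argSum_neg (a := fun j => -a j) (by simp [ha0]) (by simpa using ha1) hy
  rw [← neg_neg x₂, argSum_neg hy] at h₂
  have hc : Continuous fun x => argSum a (y, x) :=
    continuous_iff_continuousAt.2 fun x => (hasDerivAt_argSum hy).continuousAt
  exact mem_range_of_exists_le_of_exists_ge hc ⟨x₁, h₁.le⟩ ⟨-x₂, by linarith⟩

/-- The abscissa, at height `y`, of the steepest descent contour on which `expMgf a` is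
positive. -/
noncomputable def steepestAbscissa (a : ι → ℝ) (y : ℝ) : ℝ :=
  Classical.epsilon fun x => argSum a (y, x) = 0

lemma argSum_steepestAbscissa (ha0 : ∑ j, a j = 0) (ha1 : ∑ j, a j ^ 2 = 1) {y : ℝ} (hy : 0 < y) :
    argSum a (y, steepestAbscissa a y) = 0 :=
  Classical.epsilon_spec (exists_argSum_eq_zero ha0 ha1 hy)

lemma differentiableAt_steepestAbscissa (ha0 : ∑ j, a j = 0) (ha1 : ∑ j, a j ^ 2 = 1) {y : ℝ}
    (hy : 0 < y) : DifferentiableAt ℝ (steepestAbscissa a) y := by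
  have hcd : ContDiffAt ℝ 1 (argSum a) (y, steepestAbscissa a y) := contDiffAt_argSum hy
  have hinv : (fderiv ℝ (argSum a) (y, steepestAbscissa a y) ∘SL
      ContinuousLinearMap.inr ℝ ℝ ℝ).IsInvertible := by
    set d := -∑ j, a j ^ 2 * y / ‖1 - (a j : ℂ) * (steepestAbscissa a y + y * Complex.I)‖ ^ 2
      with hd
    have hd0 : d ≠ 0 := (deriv_argSum_neg ha1 hy).ne
    have hfd := (hcd.differentiableAt one_ne_zero).hasFDerivAt
    have h1 : HasDerivAt (fun x => argSum a (y, x))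
        ((fderiv ℝ (argSum a) (y, steepestAbscissa a y)) (0, 1)) (steepestAbscissa a y) :=
      hfd.comp_hasDerivAt (steepestAbscissa a y)
        ((hasDerivAt_const _ y).prodMk (hasDerivAt_id (steepestAbscissa a y)))
    have h2 := h1.unique (hasDerivAt_argSum hy)
    -- The partial derivative in x, the second coordinate, is a nonzero scalar.
    refine ⟨ContinuousLinearEquiv.unitsEquivAut ℝ (Units.mk0 d hd0), ?_⟩
    ext
    simp [h2, hd]
  have hdiff := (hcd.contDiffAt_implicitFunction one_ne_zero hinv).differentiableAt one_ne_zero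
  refine hdiff.congr_of_eventuallyEq ?_
  filter_upwards [hcd.eventually_apply_implicitFunction one_ne_zero hinv, eventually_gt_nhds hy]
    with u hu hu0
  -- Strict monotonicity in x makes the zero unique, so the chosen abscissa agrees with the implicit
  -- function nearby.
  refine (strictAnti_argSum ha1 hu0).injective ?_
  simp only [argSum_steepestAbscissa ha0 ha1 hu0]
  rw [hu, argSum_steepestAbscissa ha0 ha1 hy]

/-- The imaginary part of the primitive of `expMgf a` along the steepest descent contour. -/
noncomputable def steepestPrimitive (a : ι → ℝ) (y : ℝ) : ℝ :=
  (radialPrimitive (expMgf a) (steepestAbscissa a y + y * Complex.I)).im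

lemma expMgf_steepestAbscissa (ha0 : ∑ j, a j = 0) (ha1 : ∑ j, a j ^ 2 = 1) {y : ℝ} (hy : 0 < y) :
    expMgf a (steepestAbscissa a y + y * Complex.I) =
      (∏ j, ‖1 - (a j : ℂ) * (steepestAbscissa a y + y * Complex.I)‖⁻¹ : ℝ) := by
  have h0 := argSum_steepestAbscissa ha0 ha1 hy
  simp only [argSum] at h0
  have h1 : ∏ j, (1 - (a j : ℂ) * (steepestAbscissa a y + y * Complex.I)) =
      ∏ j, (‖1 - (a j : ℂ) * (steepestAbscissa a y + y * Complex.I)‖ : ℂ) := by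
    have : ∀ j, 1 - (a j : ℂ) * (steepestAbscissa a y + y * Complex.I) =
        ‖1 - (a j : ℂ) * (steepestAbscissa a y + y * Complex.I)‖ *
        Complex.exp ((1 - (a j : ℂ) * (steepestAbscissa a y + y * Complex.I)).arg * Complex.I) :=
      fun j => (Complex.norm_mul_exp_arg_mul_I _).symm
    rw [Finset.prod_congr rfl fun j _ => this j, Finset.prod_mul_distrib, ← Complex.exp_sum,
      ← Finset.sum_mul, ← Complex.ofReal_sum, h0]
    simp
  rw [expMgf, Finset.prod_inv_distrib, h1]
  push_cast
  rw [Finset.prod_inv_distrib]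

/-- `expMgf` is real on the contour and Im z'(y) = 1, so the derivative of the abscissa drops out.
-/
lemma hasDerivAt_steepestPrimitive (ha0 : ∑ j, a j = 0) (ha1 : ∑ j, a j ^ 2 = 1) {y : ℝ}
    (hy : 0 < y) : HasDerivAt (steepestPrimitive a)
      (∏ j, ‖1 - (a j : ℂ) * (steepestAbscissa a y + y * Complex.I)‖⁻¹) y := by
  have h1 : HasDerivAt (fun y : ℝ => (steepestAbscissa a y : ℂ) + y * Complex.I)
      ((deriv (steepestAbscissa a) y : ℝ) + Complex.I) y := by
    refine ((differentiableAt_steepestAbscissa ha0 ha1 hy).hasDerivAt.ofReal_comp.add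
      ((hasDerivAt_id y).ofReal_comp.mul_const Complex.I)).congr_deriv ?_
    simp
  have h2 := (hasDerivAt_expMgfPrimitive (a := a)
    (mem_slitDomain_of_im_pos (x := steepestAbscissa a y) hy)).comp y h1
  refine (Complex.imCLM.hasFDerivAt.comp_hasDerivAt y h2).congr_deriv ?_
  rw [expMgf_steepestAbscissa ha0 ha1 hy, Complex.imCLM_apply, Complex.im_ofReal_mul]
  simp

/-- The estimate |x| ≤ y²/2 makes the contour start at the origin, where the primitive vanishes. -/
lemma tendsto_steepestPrimitive_zero (ha0 : ∑ j, a j = 0) (ha1 : ∑ j, a j ^ 2 = 1) :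
    Tendsto (steepestPrimitive a) (𝓝[>] 0) (𝓝 0) := by
  have hid : Tendsto (fun y : ℝ => y) (𝓝[>] 0) (𝓝 0) := nhdsWithin_le_nhds
  have hx : Tendsto (steepestAbscissa a) (𝓝[>] 0) (𝓝 0) := by
    have hsq : Tendsto (fun y : ℝ => y ^ 2 / 2) (𝓝[>] 0) (𝓝 0) := by
      simpa using (hid.pow 2).div_const 2
    refine squeeze_zero_norm' ?_ hsq
    filter_upwards [Ioo_mem_nhdsGT one_pos] with y hy
    exact (steepest_bound ha0 ha1 ⟨hy.1, hy.2.trans (by linarith [Real.pi_gt_three])⟩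
      (argSum_steepestAbscissa ha0 ha1 hy.1)).2 hy.2.le
  have hz : Tendsto (fun y : ℝ => (steepestAbscissa a y : ℂ) + y * Complex.I) (𝓝[>] 0) (𝓝 0) := by
    have h1 := (Complex.continuous_ofReal.tendsto 0).comp hx
    have h2 := ((Complex.continuous_ofReal.tendsto 0).comp hid).mul_const Complex.I
    simpa using h1.add h2
  have h0 := (Complex.continuous_im.continuousAt.comp
    (hasDerivAt_expMgfPrimitive (zero_mem_slitDomain (a := a))).continuousAt).tendsto.comp hz
  have : radialPrimitive (expMgf a) 0 = 0 := by simp [radialPrimitive]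
  rw [Function.comp_apply, this, Complex.zero_im] at h0
  exact h0

lemma cotPrimitive_le_steepestPrimitive (ha0 : ∑ j, a j = 0) (ha1 : ∑ j, a j ^ 2 = 1) {y : ℝ}
    (hy : y ∈ Set.Ioo 0 Real.pi) : cotPrimitive y / Real.exp 1 ≤ steepestPrimitive a y := by
  have hd : ∀ y ∈ Set.Ioo 0 Real.pi,
      HasDerivAt (fun y => steepestPrimitive a y - cotPrimitive y / Real.exp 1) _ y := fun y hy =>
    (hasDerivAt_steepestPrimitive ha0 ha1 hy.1).sub ((hasDerivAt_cotPrimitive hy).div_const _)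
  have hmono : MonotoneOn (fun y => steepestPrimitive a y - cotPrimitive y / Real.exp 1)
      (Set.Ioo 0 Real.pi) := by
    refine monotoneOn_of_deriv_nonneg (convex_Ioo _ _)
      (fun y hy => (hd y hy).continuousAt.continuousWithinAt)
      (fun y hy => (hd y (interior_subset hy)).differentiableAt.differentiableWithinAt)
      fun y hy => ?_
    rw [interior_Ioo] at hy
    rw [(hd y hy).deriv, ← exp_cotExponent hy, sub_nonneg]
    exact (steepest_bound ha0 ha1 hy (argSum_steepestAbscissa ha0 ha1 hy.1)).1
  have hlim : Tendsto (fun y => steepestPrimitive a y - cotPrimitive y / Real.exp 1) (𝓝[>] 0)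
      (𝓝 0) := by
    simpa using (tendsto_steepestPrimitive_zero ha0 ha1).sub
      (tendsto_cotPrimitive_zero.div_const (Real.exp 1))
  have := le_of_tendsto hlim (Filter.mem_of_superset (Ioo_mem_nhdsGT hy.1) fun u hu =>
    hmono ⟨hu.1, hu.2.trans hy.2⟩ hy hu.2.le)
  linarith

lemma pi_div_exp_le_steepestPrimitive (ha0 : ∑ j, a j = 0) (ha1 : ∑ j, a j ^ 2 = 1) {y : ℝ}
    (hy : Real.pi ≤ y) : Real.pi / Real.exp 1 ≤ steepestPrimitive a y := by
  have hmono : MonotoneOn (steepestPrimitive a) (Set.Ioi 0) := by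
    refine monotoneOn_of_deriv_nonneg (convex_Ioi _)
      (fun y hy => (hasDerivAt_steepestPrimitive ha0 ha1 hy).continuousAt.continuousWithinAt)
      (fun y hy => (hasDerivAt_steepestPrimitive ha0 ha1
        (interior_subset hy)).differentiableAt.differentiableWithinAt) fun y hy => ?_
    rw [(hasDerivAt_steepestPrimitive ha0 ha1 (interior_subset hy)).deriv]
    positivity
  refine le_of_tendsto (tendsto_cotPrimitive_pi.div_const (Real.exp 1)) ?_
  filter_upwards [Ioo_mem_nhdsLT Real.pi_pos] with u hu
  exact (cotPrimitive_le_steepestPrimitive ha0 ha1 hu).trans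
    (hmono hu.1 (Set.mem_Ioi.2 (Real.pi_pos.trans_le hy)) (hu.2.le.trans hy))

/-! ### Return to the imaginary axis -/

/-- On the horizontal segment from iy to x + iy the integrand is at most c/(u² + y²), whose integral
is an arctangent. The bound is uniform in x, so the abscissa of the contour at large height need not
be controlled. -/
lemma abs_steepestPrimitive_sub_le {c R : ℝ} (hc : 0 ≤ c)
    (hbound : ∀ z : ℂ, R ≤ ‖z‖ → ‖expMgf a z‖ ≤ c / ‖z‖ ^ 2) {x y : ℝ} (hy : 0 < y) (hRy : R ≤ y) :
    |(radialPrimitive (expMgf a) (x + y * Complex.I)).im -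
      (radialPrimitive (expMgf a) (y * Complex.I)).im| ≤ c / y * (Real.pi / 2) := by
  have hder : ∀ x : ℝ, HasDerivAt
      (fun x : ℝ => (radialPrimitive (expMgf a) (x + y * Complex.I)).im)
      (expMgf a (x + y * Complex.I)).im x := by
    intro x
    have h1 : HasDerivAt (fun x : ℝ => (x : ℂ) + y * Complex.I) 1 x := by
      simpa using (hasDerivAt_id x).ofReal_comp.add_const (y * Complex.I)
    refine (Complex.imCLM.hasFDerivAt.comp_hasDerivAt x ((hasDerivAt_expMgfPrimitive (a := a)
      (mem_slitDomain_of_im_pos (x := x) hy)).comp x h1)).congr_deriv ?_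
    simp
  have hle : ∀ x : ℝ, |(expMgf a (x + y * Complex.I)).im| ≤ c / (x ^ 2 + y ^ 2) := by
    intro x
    have hsq : ‖(x : ℂ) + y * Complex.I‖ ^ 2 = x ^ 2 + y ^ 2 := by
      rw [← Complex.normSq_eq_norm_sq, Complex.normSq_add_mul_I]
    rw [← hsq]
    refine (Complex.abs_im_le_norm _).trans (hbound _ (hRy.trans ?_))
    have := Complex.abs_im_le_norm ((x : ℂ) + y * Complex.I)
    simpa [abs_of_pos hy] using this
  have hatan : ∀ x : ℝ, HasDerivAt (fun x => c / y * Real.arctan (x / y))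
      (c / (x ^ 2 + y ^ 2)) x := by
    intro x
    refine (((hasDerivAt_id x).div_const y).arctan.const_mul (c / y)).congr_deriv ?_
    have : 0 < x ^ 2 + y ^ 2 := by positivity
    simp only [id]
    field_simp
    ring
  have hm1 := monotoneOn_of_hasDerivAt convex_univ (fun x => (hatan x).add (hder x))
    fun x _ => by linarith [(abs_le.1 (hle x)).1]
  have hm2 := monotoneOn_of_hasDerivAt convex_univ (fun x => (hatan x).sub (hder x))
    fun x _ => by linarith [(abs_le.1 (hle x)).2]
  have hcy : 0 ≤ c / y := by positivity
  have hu := mul_le_mul_of_nonneg_left (Real.arctan_lt_pi_div_two (x / y)).le hcy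
  have hl := mul_le_mul_of_nonneg_left (Real.neg_pi_div_two_lt_arctan (x / y)).le hcy
  rcases le_total 0 x with hx | hx
  · have h1 := hm1 (Set.mem_univ 0) (Set.mem_univ x) hx
    have h2 := hm2 (Set.mem_univ 0) (Set.mem_univ x) hx
    simp at h1 h2
    rw [abs_le]
    constructor <;> linarith
  · have h1 := hm1 (Set.mem_univ x) (Set.mem_univ 0) hx
    have h2 := hm2 (Set.mem_univ x) (Set.mem_univ 0) hx
    simp at h1 h2
    rw [abs_le]
    constructor <;> linarith

lemma continuous_expMgf_mul_I : Continuous fun t : ℝ => expMgf a (t * Complex.I) := by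
  unfold expMgf
  refine continuous_finsetProd _ fun j _ => Continuous.inv₀ (by fun_prop) fun t h => ?_
  have := congrArg Complex.re h
  simp at this

lemma norm_expMgf_mul_I_le_one (t : ℝ) : ‖expMgf a (t * Complex.I)‖ ≤ 1 := by
  unfold expMgf
  rw [norm_prod]
  refine Finset.prod_le_one (fun _ _ => norm_nonneg _) fun j _ => ?_
  rw [norm_inv]
  refine inv_le_one_of_one_le₀ ?_
  have := Complex.abs_re_le_norm (1 - (a j : ℂ) * (t * Complex.I))
  simpa using this

lemma integrable_expMgf_mul_I (ha0 : ∑ j, a j = 0) (ha1 : ∑ j, a j ^ 2 = 1) :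
    Integrable fun t : ℝ => expMgf a (t * Complex.I) := by
  obtain ⟨c, R, hc, hR, hbound⟩ := exists_norm_expMgf_le ha0 ha1
  -- The constant covers both regimes: `expMgf` has norm at most 1 for |t| ≤ R and at most c/t²
  -- beyond.
  refine (integrable_inv_one_add_sq.const_mul (1 + R ^ 2 + c)).mono'
    continuous_expMgf_mul_I.aestronglyMeasurable (Eventually.of_forall fun t => ?_)
  have h1 := norm_expMgf_mul_I_le_one (a := a) t
  have h0 : 0 < 1 + t ^ 2 := by positivity
  rw [← div_eq_mul_inv, le_div_iff₀ h0]
  rcases le_total R |t| with h | h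
  · have := hbound (t * Complex.I) (by simpa using h)
    have ht : 0 < t ^ 2 := by
      rw [← sq_abs]; exact pow_pos (hR.trans_le h) 2
    rw [norm_mul, Complex.norm_I, mul_one, Complex.norm_real, Real.norm_eq_abs, sq_abs,
      le_div_iff₀ ht] at this
    nlinarith
  · have : t ^ 2 ≤ R ^ 2 := by rw [← sq_abs]; gcongr
    nlinarith [norm_nonneg (expMgf a (t * Complex.I))]

lemma expMgf_conj (z : ℂ) : expMgf a (starRingEnd ℂ z) = starRingEnd ℂ (expMgf a z) := by
  simp [expMgf]

/-- The density at the origin of a normalized centered sum of exponential variables, written as an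
inverse Fourier integral, is at least `1 / e`. -/
theorem inv_exp_le_integral_expMgf (ha0 : ∑ j, a j = 0) (ha1 : ∑ j, a j ^ 2 = 1) :
    1 / Real.exp 1 ≤ 1 / (2 * Real.pi) * ∫ t : ℝ, (expMgf a (t * Complex.I)).re := by
  have hint := (integrable_expMgf_mul_I ha0 ha1).re
  have hcont : Continuous fun t : ℝ => (expMgf a (t * Complex.I)).re :=
    Complex.continuous_re.comp continuous_expMgf_mul_I
  have habs : ∀ t : ℝ, (expMgf a ((|t| : ℝ) * Complex.I)).re = (expMgf a (t * Complex.I)).re := by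
    intro t
    rcases abs_choice t with h | h <;> rw [h]
    rw [show (((-t : ℝ) : ℂ) * Complex.I) = starRingEnd ℂ (t * Complex.I) by simp, expMgf_conj,
      Complex.conj_re]
  have hhalf : ∫ t : ℝ, (expMgf a (t * Complex.I)).re =
      2 * ∫ t in Set.Ioi (0 : ℝ), (expMgf a (t * Complex.I)).re := by
    rw [← integral_comp_abs (f := fun t : ℝ => (expMgf a (t * Complex.I)).re)]
    simp only [habs]
  have hprim : ∀ Y : ℝ, 0 < Y → ∫ t in (0 : ℝ)..Y, (expMgf a (t * Complex.I)).re =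
      (radialPrimitive (expMgf a) (Y * Complex.I)).im := by
    intro Y hY
    rw [intervalIntegral.integral_eq_sub_of_hasDerivAt
      (f := fun t : ℝ => (radialPrimitive (expMgf a) (t * Complex.I)).im)
      (fun t ht => ?_) (hcont.intervalIntegrable _ _)]
    · simp [radialPrimitive]
    · rw [Set.uIcc_of_le hY.le] at ht
      have hmem : (t * Complex.I : ℂ) ∈ slitDomain a := by
        intro j
        rw [Complex.mem_slitPlane_iff]
        left; simp
      have h1 : HasDerivAt (fun t : ℝ => (t : ℂ) * Complex.I) Complex.I t := by
        simpa using (hasDerivAt_id t).ofReal_comp.mul_const Complex.I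
      refine (Complex.imCLM.hasFDerivAt.comp_hasDerivAt t
        ((hasDerivAt_expMgfPrimitive hmem).comp t h1)).congr_deriv ?_
      simp
  have hlim : Tendsto (fun Y : ℝ => ∫ t in (0 : ℝ)..Y, (expMgf a (t * Complex.I)).re) atTop
      (𝓝 (∫ t in Set.Ioi (0 : ℝ), (expMgf a (t * Complex.I)).re)) :=
    intervalIntegral_tendsto_integral_Ioi 0 hint.integrableOn tendsto_id
  obtain ⟨c, R, hc, hR, hbound⟩ := exists_norm_expMgf_le ha0 ha1
  have herr : Tendsto (fun Y : ℝ => Real.pi / Real.exp 1 - c / Y * (Real.pi / 2)) atTop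
      (𝓝 (Real.pi / Real.exp 1)) := by
    have : Tendsto (fun Y : ℝ => c / Y) atTop (𝓝 0) := tendsto_const_nhds.div_atTop tendsto_id
    simpa using (this.mul_const (Real.pi / 2)).const_sub (Real.pi / Real.exp 1)
  have hfin : Real.pi / Real.exp 1 ≤ ∫ t in Set.Ioi (0 : ℝ), (expMgf a (t * Complex.I)).re := by
    refine le_of_tendsto_of_tendsto herr hlim ?_
    filter_upwards [eventually_ge_atTop R, eventually_ge_atTop Real.pi] with Y hY1 hY2
    have hY : 0 < Y := Real.pi_pos.trans_le hY2
    have h1 := pi_div_exp_le_steepestPrimitive ha0 ha1 hY2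
    have h2 := abs_steepestPrimitive_sub_le (x := steepestAbscissa a Y) hc hbound hY hY1
    rw [hprim Y hY]
    have := (abs_le.1 h2).2
    rw [steepestPrimitive] at h1
    linarith
  rw [hhalf]
  have hpi := Real.pi_pos
  calc 1 / Real.exp 1 = 1 / Real.pi * (Real.pi / Real.exp 1) := by field_simp
    _ ≤ 1 / Real.pi * ∫ t in Set.Ioi (0 : ℝ), (expMgf a (t * Complex.I)).re := by gcongr
    _ = _ := by rw [← mul_assoc]; congr 1; field_simp
end

/-! ### The exponential weight and Fourier inversion -/

/-- The density of the standard exponential distribution. -/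
noncomputable def expDensity (x : ℝ) : ℝ := (Set.Ici 0).indicator (fun x => Real.exp (-x)) x

lemma expDensity_nonneg (x : ℝ) : 0 ≤ expDensity x :=
  Set.indicator_nonneg (fun _ _ => (Real.exp_pos _).le) x

lemma measurable_expDensity : Measurable expDensity :=
  (Real.continuous_exp.comp continuous_neg).measurable.indicator measurableSet_Ici

lemma integrable_expDensity : Integrable expDensity := by
  unfold expDensity
  rw [integrable_indicator_iff measurableSet_Ici, integrableOn_Ici_iff_integrableOn_Ioi]
  exact integrableOn_exp_neg_Ioi 0

lemma expDensity_le (x : ℝ) : expDensity x ≤ Real.exp (-|x|) := by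
  unfold expDensity
  by_cases h : 0 ≤ x
  · rw [Set.indicator_of_mem (Set.mem_Ici.2 h), abs_of_nonneg h]
  · rw [Set.indicator_of_notMem (by simpa using h)]; positivity

lemma integrable_exp_neg_abs_real : Integrable fun x : ℝ => Real.exp (-|x|) := by
  refine (integrable_expDensity.add integrable_expDensity.comp_neg).mono'
    (by fun_prop) (Eventually.of_forall fun x => ?_)
  rw [Real.norm_eq_abs, abs_of_pos (Real.exp_pos _)]
  rcases le_total 0 x with h | h
  · have : expDensity x = Real.exp (-|x|) := by
      rw [expDensity, Set.indicator_of_mem (Set.mem_Ici.2 h), abs_of_nonneg h]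
    simp only [Pi.add_apply]
    linarith [expDensity_nonneg (-x)]
  · have : expDensity (-x) = Real.exp (-|x|) := by
      rw [expDensity, Set.indicator_of_mem (by simpa using h), abs_of_nonpos h]
    simp only [Pi.add_apply]
    linarith [expDensity_nonneg x]

lemma continuousAt_expDensity {x : ℝ} (hx : x ≠ 0) : ContinuousAt expDensity x := by
  rcases lt_or_gt_of_ne hx with h | h
  · refine (continuousAt_const (y := (0 : ℝ))).congr ?_
    filter_upwards [eventually_lt_nhds h] with u hu
    rw [expDensity, Set.indicator_of_notMem (by simpa using hu)]
  · refine (Real.continuous_exp.comp continuous_neg).continuousAt.congr ?_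
    filter_upwards [eventually_gt_nhds h] with u hu
    rw [expDensity, Set.indicator_of_mem (Set.mem_Ici.2 hu.le)]
    rfl

lemma integral_expDensity_mul_cexp (b : ℝ) :
    ∫ x : ℝ, (expDensity x : ℂ) * Complex.exp (x * (b * Complex.I)) =
      (1 - b * Complex.I)⁻¹ := by
  have h1 : ∀ x : ℝ, (expDensity x : ℂ) * Complex.exp (x * (b * Complex.I)) =
      (Set.Ici 0).indicator (fun x : ℝ => Complex.exp ((-1 + b * Complex.I) * x)) x := by
    intro x
    unfold expDensity
    by_cases h : x ∈ Set.Ici (0 : ℝ)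
    · rw [Set.indicator_of_mem h, Set.indicator_of_mem h, Complex.ofReal_exp, ← Complex.exp_add]
      congr 1; push_cast; ring
    · rw [Set.indicator_of_notMem h, Set.indicator_of_notMem h]; simp
  simp only [h1]
  rw [integral_indicator measurableSet_Ici, integral_Ici_eq_integral_Ioi,
    integral_exp_mul_complex_Ioi (by simp)]
  rw [Complex.ofReal_zero, mul_zero, Complex.exp_zero, neg_div, ← div_neg, one_div]
  congr 1; ring

section
variable {ι : Type*} [Fintype ι]

/-- The joint density of independent standard exponential variables. -/
noncomputable def expWeight (x : ι → ℝ) : ℝ := ∏ j, expDensity (x j)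

lemma expWeight_nonneg (x : ι → ℝ) : 0 ≤ expWeight x :=
  Finset.prod_nonneg fun _ _ => expDensity_nonneg _

lemma measurable_expWeight : Measurable (expWeight : (ι → ℝ) → ℝ) := by
  unfold expWeight
  exact Finset.measurable_fun_prod _ fun j _ => measurable_expDensity.comp (measurable_pi_apply j)

lemma integrable_expWeight : Integrable (expWeight : (ι → ℝ) → ℝ) :=
  Integrable.fintype_prod fun _ => integrable_expDensity

lemma expWeight_le (x : ι → ℝ) : expWeight x ≤ Real.exp (-∑ j, |x j|) := by
  rw [← Finset.sum_neg_distrib, Real.exp_sum]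
  exact Finset.prod_le_prod (fun _ _ => expDensity_nonneg _) fun j _ => expDensity_le _

lemma integrable_exp_neg_sum_abs : Integrable fun x : ι → ℝ => Real.exp (-∑ j, |x j|) := by
  simp only [← Finset.sum_neg_distrib, Real.exp_sum]
  exact Integrable.fintype_prod (f := fun _ x => Real.exp (-|x|))
    fun _ => integrable_exp_neg_abs_real

lemma integral_expWeight_mul_cexp (a : ι → ℝ) (t : ℝ) :
    ∫ x : ι → ℝ, (expWeight x : ℂ) * Complex.exp ((∑ j, a j * x j : ℝ) * (t * Complex.I)) =
      expMgf a (t * Complex.I) := by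
  have h1 : ∀ x : ι → ℝ,
      (expWeight x : ℂ) * Complex.exp ((∑ j, a j * x j : ℝ) * (t * Complex.I)) =
      ∏ j, (expDensity (x j) : ℂ) * Complex.exp (x j * ((a j * t : ℝ) * Complex.I)) := by
    intro x
    rw [Finset.prod_mul_distrib, ← Complex.exp_sum, expWeight]
    push_cast
    rw [Finset.sum_mul]
    congr 2
    refine Finset.sum_congr rfl fun j _ => ?_
    ring
  simp only [h1]
  rw [integral_fintype_prod_volume_eq_prod
    (fun j (x : ℝ) => (expDensity x : ℂ) * Complex.exp (x * ((a j * t : ℝ) * Complex.I)))]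
  simp only [integral_expDensity_mul_cexp, expMgf]
  refine Finset.prod_congr rfl fun j _ => ?_
  push_cast
  rw [mul_assoc]

lemma sum_abs_smul_add_le (d v : ι → ℝ) (r s : ℝ) :
    ∑ j, |(r • d + v) j| ≤ ∑ j, |(s • d + v) j| + |r - s| * ∑ j, |d j| := by
  rw [Finset.mul_sum, ← Finset.sum_add_distrib]
  refine Finset.sum_le_sum fun j _ => ?_
  rw [← abs_mul]
  refine le_trans (le_of_eq ?_) (abs_add_le _ _)
  congr 1
  simp only [Pi.add_apply, Pi.smul_apply, smul_eq_mul]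
  ring

variable {κ : Type*} [Fintype κ] {a : ι → ℝ} {d : ι → ℝ} {M : (κ → ℝ) →L[ℝ] (ι → ℝ)}

/-- Fubini gives integrability on almost every parallel slice; the triangle inequality compares any
two slices up to a constant factor. -/
lemma integrable_exp_neg_sum_abs_hyperplane
    (hmp : MeasurePreserving (fun q : ℝ × (κ → ℝ) => q.1 • d + M q.2) volume volume) (s : ℝ) :
    Integrable fun p => Real.exp (-∑ j, |(s • d + M p) j|) := by
  have hint : Integrable fun q : ℝ × (κ → ℝ) => Real.exp (-∑ j, |(q.1 • d + M q.2) j|) :=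
    (hmp.integrable_comp (g := fun x : ι → ℝ => Real.exp (-∑ j, |x j|))
      integrable_exp_neg_sum_abs.aestronglyMeasurable).2 integrable_exp_neg_sum_abs
  obtain ⟨s₀, hs₀⟩ := (Integrable.prod_right_ae hint).exists
  refine (hs₀.const_mul (Real.exp (|s₀ - s| * ∑ j, |d j|))).mono'
    (Continuous.aestronglyMeasurable (by fun_prop)) (Eventually.of_forall fun p => ?_)
  have habs := sum_abs_smul_add_le d (M p) s₀ s
  rw [Real.norm_eq_abs, abs_of_pos (Real.exp_pos _), ← Real.exp_add]
  exact Real.exp_le_exp.2 (by linarith)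

lemma integrable_expWeight_hyperplane
    (hmp : MeasurePreserving (fun q : ℝ × (κ → ℝ) => q.1 • d + M q.2) volume volume) :
    Integrable fun p => expWeight (M p) := by
  have h := integrable_exp_neg_sum_abs_hyperplane hmp 0
  simp only [zero_smul, zero_add] at h
  refine h.mono' (measurable_expWeight.comp M.continuous.measurable).aestronglyMeasurable
    (Eventually.of_forall fun p => ?_)
  rw [Real.norm_eq_abs, abs_of_nonneg (expWeight_nonneg _)]
  exact expWeight_le _

lemma continuousAt_integral_expWeight
    (hmp : MeasurePreserving (fun q : ℝ × (κ → ℝ) => q.1 • d + M q.2) volume volume)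
    (hM : ∀ j, ∃ p, M p j ≠ 0) :
    ContinuousAt (fun s : ℝ => ∫ p, expWeight (s • d + M p)) 0 := by
  refine continuousAt_of_dominated
    (bound := fun p => Real.exp (∑ j, |d j|) *
      Real.exp (-∑ j, |((0 : ℝ) • d + M p) j|)) ?_ ?_
    ((integrable_exp_neg_sum_abs_hyperplane hmp 0).const_mul _) ?_
  · refine Eventually.of_forall fun s => Measurable.aestronglyMeasurable ?_
    exact measurable_expWeight.comp (by fun_prop)
  · filter_upwards [Metric.ball_mem_nhds (0 : ℝ) one_pos] with s hs
    refine Eventually.of_forall fun p => ?_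
    rw [Real.norm_eq_abs, abs_of_nonneg (expWeight_nonneg _), ← Real.exp_add]
    refine (expWeight_le _).trans (Real.exp_le_exp.2 ?_)
    have h1 := sum_abs_smul_add_le d (M p) 0 s
    have h2 : |0 - s| ≤ 1 := by
      have hs' : |s| < 1 := by simpa using hs
      simpa using hs'.le
    have h3 := mul_le_mul_of_nonneg_right h2
      (Finset.sum_nonneg fun j (_ : j ∈ Finset.univ) => abs_nonneg (d j))
    linarith
  -- The weight jumps only where a coordinate vanishes. Each coordinate is a nonzero linear form on
  -- the hyperplane, so this is a null set.
  · have hnull : ∀ j, ∀ᵐ p : κ → ℝ, M p j ≠ 0 := by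
      intro j
      let l : (κ → ℝ) →ₗ[ℝ] ℝ := (LinearMap.proj j).comp M.toLinearMap
      have hl : LinearMap.ker l ≠ ⊤ := by
        obtain ⟨p, hp⟩ := hM j
        intro h
        have : p ∈ LinearMap.ker l := h ▸ Submodule.mem_top
        exact hp this
      have := Measure.addHaar_submodule volume _ hl
      rw [ae_iff]
      convert this using 2
      ext p
      simp [l]
    filter_upwards [ae_all_iff.2 hnull] with p hp
    unfold expWeight
    refine tendsto_finsetProd _ fun j _ => ?_
    have hc : ContinuousAt (fun s : ℝ => (s • d + M p) j) 0 := by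
      simp only [Pi.add_apply, Pi.smul_apply, smul_eq_mul]
      fun_prop
    refine ContinuousAt.comp (f := fun s : ℝ => (s • d + M p) j) (g := expDensity) ?_ hc
    exact continuousAt_expDensity (by simpa using hp j)

/-- Fourier inversion for the density at the origin of the linear form `∑ a_j x_j` with respect to
the exponential weight, the hyperplane `∑ a_j x_j = 0` being parametrized by `M`. -/
theorem integral_expWeight_hyperplane (ha0 : ∑ j, a j = 0) (ha1 : ∑ j, a j ^ 2 = 1) {k : ℝ}
    (hk : 0 < k)
    (hmp : MeasurePreserving (fun q : ℝ × (κ → ℝ) => q.1 • d + M q.2) volume volume)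
    (hd : ∀ (s : ℝ) (p : κ → ℝ), ∑ j, a j * (s • d + M p) j = k * s)
    (hM : ∀ j, ∃ p, M p j ≠ 0) :
    ∫ p, expWeight (M p) = k / (2 * Real.pi) * ∫ t : ℝ, (expMgf a (t * Complex.I)).re := by
  set f : ℝ → ℂ := fun s => ((∫ p, expWeight (s • d + M p) : ℝ) : ℂ) with hf
  have hint : Integrable fun q : ℝ × (κ → ℝ) => expWeight (q.1 • d + M q.2) :=
    (hmp.integrable_comp integrable_expWeight.aestronglyMeasurable).2 integrable_expWeight
  have hfint : Integrable f := (Integrable.integral_prod_left hint).ofReal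
  have hfcont : ContinuousAt f 0 :=
    Complex.continuous_ofReal.continuousAt.comp (continuousAt_integral_expWeight hmp hM)
  -- Fubini identifies the Fourier transform of the slice integrals with the characteristic function
  -- of ∑ a_j X_j; the factor 2π/k combines the Fourier normalization with a·x = k s.
  have hfour : ∀ w : ℝ, FourierTransform.fourier f w =
      expMgf a ((-(2 * Real.pi / k) * w : ℝ) * Complex.I) := by
    intro w
    set t : ℝ := -(2 * Real.pi / k) * w with ht
    have hmeas : AEStronglyMeasurable
        (fun x : ι → ℝ => (expWeight x : ℂ) * Complex.exp ((∑ j, a j * x j : ℝ) * (t * Complex.I)))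
        volume := by
      refine (Measurable.mul ?_ ?_).aestronglyMeasurable
      · exact Complex.measurable_ofReal.comp measurable_expWeight
      · fun_prop
    have hint' : Integrable fun q : ℝ × (κ → ℝ) => (expWeight (q.1 • d + M q.2) : ℂ) *
        Complex.exp ((∑ j, a j * (q.1 • d + M q.2) j : ℝ) * (t * Complex.I)) := by
      refine hint.mono (hmeas.comp_measurePreserving hmp) (Eventually.of_forall fun q => ?_)
      rw [norm_mul, ← mul_assoc, ← Complex.ofReal_mul, Complex.norm_exp_ofReal_mul_I, mul_one,
        Complex.norm_real]
    have hmp' := hmp.map_eq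
    rw [← integral_expWeight_mul_cexp a t, ← hmp', integral_map hmp.measurable.aemeasurable
      (by rw [hmp']; exact hmeas)]
    rw [Measure.volume_eq_prod, integral_prod _ hint', Real.fourier_real_eq_integral_exp_smul]
    refine integral_congr_ae (Eventually.of_forall fun s => ?_)
    simp only [hd, hf]
    rw [integral_mul_const, smul_eq_mul, mul_comm, integral_complex_ofReal]
    congr 2
    rw [ht]
    push_cast
    have : (k : ℂ) ≠ 0 := by exact_mod_cast hk.ne'
    field_simp
  have hfourint : Integrable (FourierTransform.fourier f) := by
    rw [show FourierTransform.fourier f = fun w : ℝ =>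
      expMgf a ((-(2 * Real.pi / k) * w : ℝ) * Complex.I) from funext hfour]
    exact (integrable_expMgf_mul_I ha0 ha1).comp_mul_left' (by
      have := Real.pi_pos
      have : 0 < 2 * Real.pi / k := by positivity
      exact (neg_neg_of_pos this).ne)
  have hinv := hfint.fourierInv_fourier_eq hfourint hfcont
  rw [Real.fourierInv_eq'] at hinv
  simp only [hfour, inner_zero_right, mul_zero, Complex.ofReal_zero, zero_mul, Complex.exp_zero,
    one_smul] at hinv
  rw [Measure.integral_comp_mul_left (fun t : ℝ => expMgf a ((t : ℝ) * Complex.I))] at hinv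
  have hre := congrArg Complex.re hinv
  simp only [hf, zero_smul, zero_add, Complex.ofReal_re] at hre
  rw [← hre, Complex.smul_re, smul_eq_mul]
  have hreal : (∫ t : ℝ, expMgf a (t * Complex.I)).re = ∫ t : ℝ, (expMgf a (t * Complex.I)).re :=
    (Complex.reCLM.integral_comp_comm (integrable_expMgf_mul_I ha0 ha1)).symm
  rw [hreal]
  congr 1
  rw [inv_neg, abs_neg, inv_div, abs_of_pos]
  have := Real.pi_pos
  positivity
end

lemma expWeight_eq_zero {ι : Type*} [Fintype ι] {x : ι → ℝ} (h : ¬ ∀ j, 0 ≤ x j) :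
    expWeight x = 0 := by
  push Not at h
  obtain ⟨j, hj⟩ := h
  refine Finset.prod_eq_zero (Finset.mem_univ j) ?_
  rw [expDensity, Set.indicator_of_notMem (by simpa using hj)]

lemma expWeight_of_nonneg {ι : Type*} [Fintype ι] {x : ι → ℝ} (h : ∀ j, 0 ≤ x j) :
    expWeight x = Real.exp (-∑ j, x j) := by
  rw [← Finset.sum_neg_distrib, Real.exp_sum]
  refine Finset.prod_congr rfl fun j _ => ?_
  rw [expDensity, Set.indicator_of_mem (Set.mem_Ici.2 (h j))]

/-! ### The density for a facet normal -/

lemma measurePreserving_insertNth {n : ℕ} (i : Fin (n + 1)) :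
    MeasurePreserving (fun q : ℝ × (Fin n → ℝ) => (i.insertNth q.1 q.2 : Fin (n + 1) → ℝ))
      volume volume :=
  (volume_preserving_piFinSuccAbove (fun _ : Fin (n + 1) => ℝ) i).symm

/-- Graph parametrization of the hyperplane `n x_i = ∑_{j ≠ i} x_j`. -/
noncomputable def facetParam (n : ℕ) (i : Fin (n + 1)) : (Fin n → ℝ) →L[ℝ] (Fin (n + 1) → ℝ) :=
  ContinuousLinearMap.pi (i.insertNth (α := fun _ => (Fin n → ℝ) →L[ℝ] ℝ)
    ((1 / (n : ℝ)) • ∑ l, ContinuousLinearMap.proj l) fun l => ContinuousLinearMap.proj l)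

lemma facetParam_apply (n : ℕ) (i : Fin (n + 1)) (y : Fin n → ℝ) :
    facetParam n i y = i.insertNth (1 / (n : ℝ) * ∑ l, y l) y := by
  ext j
  refine Fin.succAboveCases i ?_ (fun l => ?_) j
  · simp [facetParam]
  · simp [facetParam]

lemma measurePreserving_facetParam (n : ℕ) (i : Fin (n + 1)) :
    MeasurePreserving (fun q : ℝ × (Fin n → ℝ) =>
      q.1 • (Pi.single i 1 : Fin (n + 1) → ℝ) + facetParam n i q.2) volume volume := by
  -- The parametrization is a shear in coordinate i followed by insertion of that coordinate.
  have hshear : MeasurePreserving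
      (fun q : (Fin n → ℝ) × ℝ => (q.1, q.2 + 1 / (n : ℝ) * ∑ l, q.1 l))
      (volume.prod volume) (volume.prod volume) := by
    refine (MeasurePreserving.id _).skew_product (g := fun (y : Fin n → ℝ) s => s + 1 / (n : ℝ) * ∑ l, y l)
      ?_ (Eventually.of_forall fun y => ?_)
    · unfold Function.uncurry; fun_prop
    · exact (measurePreserving_add_right volume _).map_eq
  have h := (measurePreserving_insertNth i).comp
    (Measure.measurePreserving_swap.comp (hshear.comp Measure.measurePreserving_swap))
  suffices heq : (fun q : ℝ × (Fin n → ℝ) =>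
      q.1 • (Pi.single i 1 : Fin (n + 1) → ℝ) + facetParam n i q.2) = _ by
    rw [heq]; exact h
  funext q
  ext j
  rw [facetParam_apply]
  refine Fin.succAboveCases i ?_ (fun l => ?_) j
  · simp
  · simp [Fin.succAbove_ne]

/-- Solving for x_i makes the total sum (n+1)/n times the sum of the free coordinates, so the weight
factorizes and the integral is elementary. -/
lemma expWeight_facetParam {n : ℕ} (i : Fin (n + 1)) (y : Fin n → ℝ) :
    expWeight (facetParam n i y) =
      ∏ l, (Set.Ici 0).indicator (fun x => Real.exp (-(((n : ℝ) + 1) / n * x))) (y l) := by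
  by_cases h : ∀ l, 0 ≤ y l
  · have hs : 0 ≤ 1 / (n : ℝ) * ∑ l, y l :=
      mul_nonneg (by positivity) (Finset.sum_nonneg fun l _ => h l)
    rw [expWeight_of_nonneg]
    · rw [Finset.prod_congr rfl fun l _ => Set.indicator_of_mem (Set.mem_Ici.2 (h l)) _,
        ← Real.exp_sum, facetParam_apply, Fin.sum_univ_succAbove _ i]
      simp only [Fin.insertNth_apply_same, Fin.insertNth_apply_succAbove, Finset.sum_neg_distrib,
        ← Finset.mul_sum]
      congr 2
      rcases Nat.eq_zero_or_pos n with rfl | hn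
      · simp
      · field_simp; ring
    · intro j
      rw [facetParam_apply]
      refine Fin.succAboveCases i ?_ (fun l => ?_) j
      · simpa using hs
      · simpa using h l
  · rw [expWeight_eq_zero]
    · push Not at h
      obtain ⟨l, hl⟩ := h
      refine (Finset.prod_eq_zero (Finset.mem_univ l) ?_).symm
      rw [Set.indicator_of_notMem (by simpa using hl)]
    · intro hall
      refine h fun l => ?_
      have := hall (i.succAbove l)
      rwa [facetParam_apply, Fin.insertNth_apply_succAbove] at this

lemma integral_expWeight_facetParam {n : ℕ} (hn : 0 < n) (i : Fin (n + 1)) :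
    ∫ y, expWeight (facetParam n i y) = ((n : ℝ) / (n + 1)) ^ n := by
  simp only [expWeight_facetParam]
  rw [integral_fintype_prod_volume_eq_prod
    (fun _ : Fin n => (Set.Ici 0).indicator fun x => Real.exp (-(((n : ℝ) + 1) / n * x)))]
  have h1 : ∫ x : ℝ, (Set.Ici 0).indicator (fun x => Real.exp (-(((n : ℝ) + 1) / n * x))) x =
      (n : ℝ) / (n + 1) := by
    have hneg : -(((n : ℝ) + 1) / n) < 0 := by
      rw [neg_lt_zero]; positivity
    rw [integral_indicator measurableSet_Ici, integral_Ici_eq_integral_Ioi]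
    simp only [← neg_mul]
    rw [integral_exp_mul_Ioi hneg]
    simp
  rw [h1]
  simp [div_pow]

/-- The density at the origin for the unit normal of a facet-parallel central hyperplane. -/
lemma integral_expMgf_facet {n : ℕ} (hn : 0 < n) (i : Fin (n + 1)) {a : Fin (n + 1) → ℝ} {p : ℝ}
    (hp : 0 < p) (hai : a i = p) (haj : ∀ l, a (i.succAbove l) = -p / n)
    (ha1 : ∑ j, a j ^ 2 = 1) :
    1 / (2 * Real.pi) * ∫ t : ℝ, (expMgf a (t * Complex.I)).re =
      1 / p * ((n : ℝ) / (n + 1)) ^ n := by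
  have hn' : (n : ℝ) ≠ 0 := by positivity
  have ha0 : ∑ j, a j = 0 := by
    rw [Fin.sum_univ_succAbove _ i, hai]
    simp only [haj, Finset.sum_const, Finset.card_univ, Fintype.card_fin, nsmul_eq_mul]
    field_simp; ring
  have h := integral_expWeight_hyperplane ha0 ha1 hp (measurePreserving_facetParam n i)
    (fun s y => by
      rw [Fin.sum_univ_succAbove _ i, hai, facetParam_apply]
      simp only [haj, Pi.add_apply, Pi.smul_apply, Pi.single_eq_same, Fin.insertNth_apply_same,
        Fin.insertNth_apply_succAbove, smul_eq_mul, mul_one, Pi.single_apply, Fin.succAbove_ne,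
        if_false, mul_zero, zero_add, ← Finset.mul_sum]
      field_simp; ring)
    (fun j => ⟨fun _ => 1, by
      rw [facetParam_apply]
      refine Fin.succAboveCases i ?_ (fun l => ?_) j
      · simp [hn']
      · simp⟩)
  rw [integral_expWeight_facetParam hn] at h
  rw [h, ← mul_assoc]
  congr 1
  field_simp

/-! ### Normals of central hyperplanes -/

lemma mem_regularSimplex {n : ℕ} {x : EuclideanSpace ℝ (Fin (n + 1))} :
    x ∈ regularSimplex n ↔ (∀ j, 0 ≤ x j) ∧ ∑ j, x j = 1 := by
  have h1 : regularSimplex n =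
      (WithLp.linearEquiv 2 ℝ (Fin (n + 1) → ℝ)).symm '' stdSimplex ℝ (Fin (n + 1)) := by
    rw [← convexHull_rangle_single_eq_stdSimplex, ← LinearEquiv.coe_coe,
      LinearMap.image_convexHull, ← Set.range_comp]
    rfl
  rw [h1]
  constructor
  · rintro ⟨y, hy, rfl⟩
    exact hy
  · intro hx
    exact ⟨x.ofLp, hx, rfl⟩

lemma mem_affineSpan_regularSimplex {n : ℕ} {x : EuclideanSpace ℝ (Fin (n + 1))}
    (hx : ∑ j, x j = 1) : x ∈ affineSpan ℝ (regularSimplex n) := by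
  rw [regularSimplex, affineSpan_convexHull]
  have h := affineCombination_mem_affineSpan hx
    fun i : Fin (n + 1) => EuclideanSpace.single i (1 : ℝ)
  rw [Finset.affineCombination_eq_linear_combination _ _ _ hx] at h
  convert h using 1
  ext j
  simp [Finset.sum_apply, Pi.single_apply]

lemma simplexCenter_apply (n : ℕ) (j : Fin (n + 1)) : simplexCenter n j = 1 / ((n : ℝ) + 1) := rfl

lemma sum_simplexCenter (n : ℕ) : ∑ j, simplexCenter n j = 1 := by
  simp only [simplexCenter_apply, Finset.sum_const, Finset.card_univ, Fintype.card_fin,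
    nsmul_eq_mul]
  push_cast
  field_simp

/-- A central hyperplane is cut out, within the affine hull of the simplex, by a unit normal
vector with coordinate sum zero. -/
lemma IsCentralHyperplane.exists_normal {n : ℕ}
    {H : AffineSubspace ℝ (EuclideanSpace ℝ (Fin (n + 1)))} (hH : IsCentralHyperplane n H) :
    ∃ a : Fin (n + 1) → ℝ, ∑ j, a j = 0 ∧ ∑ j, a j ^ 2 = 1 ∧
      ∀ x : EuclideanSpace ℝ (Fin (n + 1)), ∑ j, x j = 1 → (x ∈ H ↔ ∑ j, a j * x j = 0) := by
  have hfin : Module.finrank ℝ (H.directionᗮ : Submodule ℝ _) = 1 := by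
    have := H.direction.finrank_add_finrank_orthogonal
    rw [hH.finrank_direction, finrank_euclideanSpace_fin] at this
    omega
  obtain ⟨⟨b, hbmem⟩, hb0, hbspan⟩ := finrank_eq_one_iff'.1 hfin
  have hb0' : b ≠ 0 := fun h => hb0 (Subtype.ext h)
  have hdir : ∀ v, v ∈ H.direction ↔ inner ℝ b v = 0 := by
    intro v
    constructor
    · intro hv
      exact (Submodule.mem_orthogonal' _ _).1 hbmem v hv
    · intro hv
      rw [← Submodule.orthogonal_orthogonal H.direction, Submodule.mem_orthogonal]
      intro u hu
      obtain ⟨c, hc⟩ := hbspan ⟨u, hu⟩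
      have hu' : u = c • b := (congrArg Subtype.val hc).symm
      rw [hu', real_inner_smul_left, hv, mul_zero]
  have hmem : ∀ x, x ∈ H ↔ ∑ j, b j * (x j - simplexCenter n j) = 0 := by
    intro x
    rw [← AffineSubspace.vsub_right_mem_direction_iff_mem hH.center_mem, hdir, PiLp.inner_apply]
    simp [mul_comm]
  -- Subtracting the mean projects the normal onto the sum-zero vectors. The projection is nonzero,
  -- since a constant normal would make H the affine hull of the simplex.
  set β : ℝ := (∑ j, b j) / (n + 1) with hβ
  set a' : Fin (n + 1) → ℝ := fun j => b j - β with ha'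
  have ha'0 : ∑ j, a' j = 0 := by
    simp only [ha', Finset.sum_sub_distrib, Finset.sum_const, Finset.card_univ, Fintype.card_fin,
      nsmul_eq_mul, hβ]
    push_cast
    field_simp
    ring
  have hmem' : ∀ x : EuclideanSpace ℝ (Fin (n + 1)), ∑ j, x j = 1 →
      (x ∈ H ↔ ∑ j, a' j * x j = 0) := by
    intro x hx
    rw [hmem]
    have : ∑ j, a' j * x j = ∑ j, b j * (x j - simplexCenter n j) := by
      have h1 : ∀ j, b j * (x j - simplexCenter n j) =
          a' j * x j + β * x j - b j * (1 / ((n : ℝ) + 1)) := by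
        intro j
        simp only [ha', simplexCenter_apply]
        ring
      simp only [h1, Finset.sum_sub_distrib, Finset.sum_add_distrib, ← Finset.mul_sum,
        ← Finset.sum_mul, hx, hβ]
      ring
    rw [this]
  have hne : 0 < ∑ j, a' j ^ 2 := by
    refine lt_of_le_of_ne (Finset.sum_nonneg fun j _ => sq_nonneg _) fun h => ?_
    have hz : ∀ j, a' j = 0 := fun j => by
      have := (Finset.sum_eq_zero_iff_of_nonneg fun j _ => sq_nonneg (a' j)).1 h.symm j
        (Finset.mem_univ j)
      exact pow_eq_zero_iff two_ne_zero |>.1 this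
    have hbj : ∀ j, b j = β := fun j => sub_eq_zero.1 (hz j)
    have hβ0 : β ≠ 0 := by
      intro h0
      refine hb0' ?_
      ext j
      simp [hbj, h0]
    refine hH.ne_affineSpan (le_antisymm (fun x hx => mem_affineSpan_regularSimplex ?_)
      (affineSpan_le.2 fun x hx => ?_))
    · rw [hmem] at hx
      simp only [hbj, ← Finset.mul_sum, Finset.sum_sub_distrib, sum_simplexCenter] at hx
      linarith [(mul_eq_zero.1 hx).resolve_left hβ0]
    · refine (hmem' x (mem_regularSimplex.1 hx).2).2 ?_
      simp [hz]
  set ρ : ℝ := √(∑ j, a' j ^ 2) with hρ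
  have hρ0 : 0 < ρ := Real.sqrt_pos.2 hne
  refine ⟨fun j => a' j / ρ, ?_, ?_, fun x hx => ?_⟩
  · rw [← Finset.sum_div, ha'0, zero_div]
  · simp only [div_pow]
    rw [← Finset.sum_div, hρ, Real.sq_sqrt hne.le, div_self hne.ne']
  · rw [hmem' x hx]
    have : ∑ j, a' j / ρ * x j = (∑ j, a' j * x j) / ρ := by
      rw [Finset.sum_div]
      exact Finset.sum_congr rfl fun j _ => by ring
    rw [this, div_eq_zero_iff, or_iff_left hρ0.ne']

/-! ### Section volume as a density at the origin -/

/-- Parametrization of the hyperplane orthogonal to the first vector of an orthonormal basis. -/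
noncomputable def frameParam {k : ℕ}
    (b : OrthonormalBasis (Fin (k + 1)) ℝ (EuclideanSpace ℝ (Fin (k + 1)))) :
    (Fin k → ℝ) →L[ℝ] (Fin (k + 1) → ℝ) :=
  ContinuousLinearMap.pi fun j => ∑ l : Fin k, b l.succ j • ContinuousLinearMap.proj l

lemma frameParam_apply {k : ℕ}
    (b : OrthonormalBasis (Fin (k + 1)) ℝ (EuclideanSpace ℝ (Fin (k + 1)))) (p : Fin k → ℝ)
    (j : Fin (k + 1)) : frameParam b p j = ∑ l, p l * b l.succ j := by
  simp [frameParam, mul_comm]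

lemma measurePreserving_frameParam {k : ℕ}
    (b : OrthonormalBasis (Fin (k + 1)) ℝ (EuclideanSpace ℝ (Fin (k + 1)))) :
    MeasurePreserving (fun q : ℝ × (Fin k → ℝ) => q.1 • (b 0).ofLp + frameParam b q.2)
      volume volume := by
  have h := (PiLp.volume_preserving_ofLp (Fin (k + 1))).comp
    (b.measurePreserving_repr_symm.comp ((PiLp.volume_preserving_toLp (Fin (k + 1))).comp
      (measurePreserving_insertNth 0)))
  suffices heq : (fun q : ℝ × (Fin k → ℝ) => q.1 • (b 0).ofLp + frameParam b q.2) = _ by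
    rw [heq]; exact h
  funext q
  ext j
  simp only [Function.comp_apply, ← OrthonormalBasis.sum_repr_symm, Fin.sum_univ_succ]
  simp [frameParam_apply]

section
variable {m : ℕ} (b : OrthonormalBasis (Fin (m + 2)) ℝ (EuclideanSpace ℝ (Fin (m + 2))))

/-- The coordinates, in the orthonormal frame `b 2, b 3, …`, of the points of the simplex in the
affine subspace through the center that is spanned by this frame. -/
def sectionCoords : Set (Fin m → ℝ) :=
  {w | ∀ j, 0 ≤ 1 / ((m : ℝ) + 2) + ∑ l, w l * b l.succ.succ j}

lemma measurableSet_sectionCoords : MeasurableSet (sectionCoords b) := by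
  have : sectionCoords b = ⋂ j, {w | 0 ≤ 1 / ((m : ℝ) + 2) + ∑ l, w l * b l.succ.succ j} := by
    ext w; simp [sectionCoords]
  rw [this]
  exact MeasurableSet.iInter fun j => measurableSet_le measurable_const (by fun_prop)

variable {b}

lemma sum_frame_eq_zero (hb1 : ∀ j, b 1 j = 1 / √((m : ℝ) + 2)) (l : Fin m) :
    ∑ j, b l.succ.succ j = 0 := by
  have h : inner ℝ (b 1) (b l.succ.succ) = 0 :=
    b.orthonormal.2 fun h => by
      have := congrArg Fin.val h
      simp at this
  rw [PiLp.inner_apply] at h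
  simp only [hb1, RCLike.inner_apply, conj_trivial, ← Finset.sum_mul] at h
  refine (mul_eq_zero.1 h).resolve_right ?_
  positivity

lemma expWeight_frameParam_of_neg (hb1 : ∀ j, b 1 j = 1 / √((m : ℝ) + 2)) {r : ℝ} (hr : r < 0)
    (w : Fin m → ℝ) : expWeight (frameParam b (Fin.insertNth 0 r w : Fin (m + 1) → ℝ)) = 0 := by
  refine expWeight_eq_zero fun h => ?_
  have hsum := Finset.sum_nonneg fun j (_ : j ∈ Finset.univ) => h j
  simp only [frameParam_apply, Fin.sum_univ_succ (n := m), Fin.insertNth_zero', Fin.cons_zero,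
    Fin.cons_succ, Fin.succ_zero_eq_one, hb1, Finset.sum_add_distrib] at hsum
  rw [Finset.sum_comm] at hsum
  simp only [← Finset.mul_sum, sum_frame_eq_zero hb1, mul_zero, Finset.sum_const_zero, add_zero,
    Finset.sum_const, Finset.card_univ, Fintype.card_fin, nsmul_eq_mul] at hsum
  have : ((m + 2 : ℕ) : ℝ) * (r * (1 / √((m : ℝ) + 2))) < 0 := by
    refine mul_neg_of_pos_of_neg (by positivity) (mul_neg_of_neg_of_pos hr (by positivity))
  linarith

lemma expWeight_frameParam_of_pos (hb1 : ∀ j, b 1 j = 1 / √((m : ℝ) + 2)) {r : ℝ} (hr : 0 < r)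
    (w : Fin m → ℝ) : expWeight (frameParam b (Fin.insertNth 0 r w : Fin (m + 1) → ℝ)) =
      (sectionCoords b).indicator (fun _ => Real.exp (-(√((m : ℝ) + 2) * r)))
        ((r * √((m : ℝ) + 2))⁻¹ • w) := by
  have hN : 0 < √((m : ℝ) + 2) := by positivity
  have hN2 : √((m : ℝ) + 2) ^ 2 = m + 2 := Real.sq_sqrt (by positivity)
  set N := √((m : ℝ) + 2) with hNdef
  have hval : ∀ j, frameParam b (Fin.insertNth 0 r w : Fin (m + 1) → ℝ) j =
      r * (1 / N) + ∑ l, w l * b l.succ.succ j := by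
    intro j
    simp only [frameParam_apply, Fin.sum_univ_succ (n := m), Fin.insertNth_zero', Fin.cons_zero,
      Fin.cons_succ, Fin.succ_zero_eq_one, hb1]
  have hscale : ∀ j, frameParam b (Fin.insertNth 0 r w : Fin (m + 1) → ℝ) j =
      (r * N) * (1 / ((m : ℝ) + 2) + ∑ l, ((r * N)⁻¹ • w) l * b l.succ.succ j) := by
    intro j
    rw [hval, ← hN2, mul_add, Finset.mul_sum]
    congr 1
    · field_simp
    · refine Finset.sum_congr rfl fun l _ => ?_
      simp only [Pi.smul_apply, smul_eq_mul]
      field_simp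
  by_cases h : (r * N)⁻¹ • w ∈ sectionCoords b
  · rw [Set.indicator_of_mem h, expWeight_of_nonneg]
    · congr 2
      simp only [hval, Finset.sum_add_distrib]
      rw [Finset.sum_comm]
      simp only [← Finset.mul_sum, sum_frame_eq_zero hb1, mul_zero, Finset.sum_const_zero,
        add_zero, Finset.sum_const, Finset.card_univ, Fintype.card_fin, nsmul_eq_mul]
      push_cast
      rw [show (m : ℝ) + 1 + 1 = N ^ 2 by rw [hN2]; ring]
      field_simp
    · intro j
      rw [hscale]
      exact mul_nonneg (by positivity) (h j)
  · rw [Set.indicator_of_notMem h, expWeight_eq_zero]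
    intro hall
    refine h fun j => ?_
    have := hall j
    rw [hscale] at this
    exact nonneg_of_mul_nonneg_right this (by positivity)

/-- Slice along `b 1`, the diagonal direction. With N = √(m+2), at level r > 0 the coordinates sum
to rN, the weight is the constant e^{-Nr}, and its support is the section dilated by rN. Integrating
(rN)^m e^{-Nr} gives m!/N. -/
lemma integral_expWeight_frameParam (hb1 : ∀ j, b 1 j = 1 / √((m : ℝ) + 2)) :
    ∫ p, expWeight (frameParam b p) =
      (m.factorial : ℝ) / √((m : ℝ) + 2) * volume.real (sectionCoords b) := by
  have hint := integrable_expWeight_hyperplane (measurePreserving_frameParam b)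
  have hmp := measurePreserving_insertNth (0 : Fin (m + 1))
  have hint' : Integrable fun q : ℝ × (Fin m → ℝ) =>
      expWeight (frameParam b (Fin.insertNth 0 q.1 q.2 : Fin (m + 1) → ℝ)) :=
    (hmp.integrable_comp hint.aestronglyMeasurable).2 hint
  have hN : 0 < √((m : ℝ) + 2) := by positivity
  rw [← hmp.map_eq, integral_map hmp.measurable.aemeasurable
    (by rw [hmp.map_eq]; exact hint.aestronglyMeasurable), Measure.volume_eq_prod,
    integral_prod _ hint']
  have hinner : (fun r : ℝ => ∫ w, expWeight
      (frameParam b (Fin.insertNth 0 r w : Fin (m + 1) → ℝ))) =ᵐ[volume]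
      (Set.Ioi 0).indicator fun r => (r ^ ((m : ℝ) + 1 - 1) * Real.exp (-(√((m : ℝ) + 2) * r))) *
        (√((m : ℝ) + 2) ^ m * volume.real (sectionCoords b)) := by
    filter_upwards [Measure.ae_ne volume (0 : ℝ)] with r hr0
    rcases lt_or_gt_of_ne hr0 with hr | hr
    · simp only [expWeight_frameParam_of_neg hb1 hr, integral_zero]
      rw [Set.indicator_of_notMem (by simpa using hr.le)]
    · simp only [expWeight_frameParam_of_pos hb1 hr]
      rw [Set.indicator_of_mem (Set.mem_Ioi.2 hr), Measure.integral_comp_smul volume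
        ((sectionCoords b).indicator fun _ => Real.exp (-(√((m : ℝ) + 2) * r))),
        integral_indicator (measurableSet_sectionCoords b), setIntegral_const]
      rw [Module.finrank_fin_fun, inv_pow, inv_inv, abs_of_pos (by positivity), add_sub_cancel_right,
        Real.rpow_natCast, mul_pow, smul_eq_mul, smul_eq_mul]
      ring
  rw [integral_congr_ae hinner, integral_indicator measurableSet_Ioi, integral_mul_const,
    Real.integral_rpow_mul_exp_neg_mul_Ioi (by positivity) hN, Real.Gamma_nat_eq_factorial]
  rw [show ((m : ℝ) + 1) = ((m + 1 : ℕ) : ℝ) by push_cast; ring, Real.rpow_natCast, pow_succ]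
  field_simp
  rw [← mul_pow, one_div_mul_cancel hN.ne', one_pow, one_mul]

lemma euclideanHausdorffMeasure_section (hb1 : ∀ j, b 1 j = 1 / √((m : ℝ) + 2))
    {H : AffineSubspace ℝ (EuclideanSpace ℝ (Fin (m + 2)))}
    (hH : ∀ x : EuclideanSpace ℝ (Fin (m + 2)), ∑ j, x j = 1 → (x ∈ H ↔ ∑ j, b 0 j * x j = 0)) :
    sectionVolume (m + 1) H = volume.real (sectionCoords b) := by
  have hb0 : ∑ j, b 0 j = 0 := by
    have h : inner ℝ (b 1) (b 0) = 0 := b.orthonormal.2 (by simp)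
    rw [PiLp.inner_apply] at h
    simp only [hb1, RCLike.inner_apply, conj_trivial, ← Finset.sum_mul] at h
    exact (mul_eq_zero.1 h).resolve_right (by positivity)
  -- An isometric embedding carrying the coordinate set onto the section, so that Hausdorff measure
  -- becomes Lebesgue measure.
  set T : EuclideanSpace ℝ (Fin m) → EuclideanSpace ℝ (Fin (m + 2)) :=
    fun v => simplexCenter (m + 1) + ∑ l, v l • b l.succ.succ with hT
  have hTapply : ∀ v j, T v j = 1 / ((m : ℝ) + 2) + ∑ l, v l * b l.succ.succ j := by
    intro v j
    simp only [hT, PiLp.add_apply, simplexCenter_apply, WithLp.ofLp_sum, Finset.sum_apply,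
      PiLp.smul_apply, smul_eq_mul]
    congr 2
    push_cast; ring
  have hort : Orthonormal ℝ fun l : Fin m => b l.succ.succ :=
    b.orthonormal.comp _ ((Fin.succ_injective _).comp (Fin.succ_injective _))
  have hiso : Isometry T := by
    refine Isometry.of_dist_eq fun u v => ?_
    rw [dist_eq_norm, dist_eq_norm, hT]
    simp only [add_sub_add_left_eq_sub, ← Finset.sum_sub_distrib, ← sub_smul]
    rw [← sq_eq_sq₀ (norm_nonneg _) (norm_nonneg _), ← real_inner_self_eq_norm_sq,
      hort.inner_sum, EuclideanSpace.norm_sq_eq]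
    refine Finset.sum_congr rfl fun l _ => ?_
    rw [conj_trivial, Real.norm_eq_abs, sq_abs, PiLp.sub_apply, sq]
  have himage : (H : Set (EuclideanSpace ℝ (Fin (m + 2)))) ∩ regularSimplex (m + 1) =
      T '' (WithLp.ofLp ⁻¹' sectionCoords b) := by
    ext x
    constructor
    · rintro ⟨hxH, hxΔ⟩
      obtain ⟨hx0, hx1⟩ := mem_regularSimplex.1 hxΔ
      have hrepr := b.sum_repr (x - simplexCenter (m + 1))
      have h0 : b.repr (x - simplexCenter (m + 1)) 0 = 0 := by
        rw [OrthonormalBasis.repr_apply_apply, PiLp.inner_apply]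
        simp only [PiLp.sub_apply, RCLike.inner_apply, conj_trivial, sub_mul,
          Finset.sum_sub_distrib, simplexCenter_apply, ← Finset.mul_sum, hb0, mul_zero, sub_zero]
        rw [← (hH x hx1).1 hxH]
        exact Finset.sum_congr rfl fun j _ => mul_comm _ _
      have h1 : b.repr (x - simplexCenter (m + 1)) 1 = 0 := by
        rw [OrthonormalBasis.repr_apply_apply, PiLp.inner_apply]
        simp only [PiLp.sub_apply, RCLike.inner_apply, conj_trivial, hb1, ← Finset.sum_mul,
          Finset.sum_sub_distrib, hx1, sum_simplexCenter, sub_self, zero_mul]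
      rw [Fin.sum_univ_succ, h0, zero_smul, zero_add, Fin.sum_univ_succ, Fin.succ_zero_eq_one, h1,
        zero_smul, zero_add] at hrepr
      have hTx : T (WithLp.toLp 2 fun l => b.repr (x - simplexCenter (m + 1)) l.succ.succ) = x := by
        simp only [hT, hrepr]
        exact add_sub_cancel _ _
      refine ⟨_, fun j => ?_, hTx⟩
      rw [← hTapply, hTx]
      exact hx0 j
    · rintro ⟨v, hv, rfl⟩
      have hsum : ∑ j, T v j = 1 := by
        simp only [hTapply, Finset.sum_add_distrib]
        rw [Finset.sum_comm]
        simp only [← Finset.mul_sum, sum_frame_eq_zero hb1, mul_zero, Finset.sum_const_zero,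
          add_zero, Finset.sum_const, Finset.card_univ, Fintype.card_fin, nsmul_eq_mul]
        push_cast
        field_simp
      refine ⟨(hH _ hsum).2 ?_, mem_regularSimplex.2 ⟨fun j => ?_, hsum⟩⟩
      · have hinner : inner ℝ (b 0) (T v) = 0 := by
          simp only [hT, inner_add_right, inner_sum, inner_smul_right]
          have h1 : inner ℝ (b 0) (simplexCenter (m + 1)) = 0 := by
            rw [PiLp.inner_apply]
            simp only [simplexCenter_apply, RCLike.inner_apply, conj_trivial, ← Finset.mul_sum,
              hb0, mul_zero]
          have h2 : ∀ l : Fin m, inner ℝ (b 0) (b l.succ.succ) = 0 := fun l =>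
            b.orthonormal.2 (Fin.succ_ne_zero _).symm
          simp [h1, h2]
        rw [PiLp.inner_apply] at hinner
        rw [← hinner]
        exact Finset.sum_congr rfl fun j _ => mul_comm _ _
      · rw [hTapply]
        exact hv j
  rw [sectionVolume, himage, Measure.real, Nat.add_sub_cancel,
    hiso.euclideanHausdorffMeasure_image, EuclideanSpace.euclideanHausdorffMeasure_eq_volume,
    (PiLp.volume_preserving_ofLp (Fin m)).measure_preimage
      (measurableSet_sectionCoords b).nullMeasurableSet]
  rfl
end

/-- The volume of a central section in terms of the density at the origin of a sum of exponential
variables. -/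
theorem sectionVolume_eq {m : ℕ} {H : AffineSubspace ℝ (EuclideanSpace ℝ (Fin (m + 2)))}
    {a : Fin (m + 2) → ℝ} (ha0 : ∑ j, a j = 0) (ha1 : ∑ j, a j ^ 2 = 1)
    (hH : ∀ x : EuclideanSpace ℝ (Fin (m + 2)), ∑ j, x j = 1 → (x ∈ H ↔ ∑ j, a j * x j = 0)) :
    sectionVolume (m + 1) H = √((m : ℝ) + 2) / m.factorial *
      (1 / (2 * Real.pi) * ∫ t : ℝ, (expMgf a (t * Complex.I)).re) := by
  have hN : 0 < √((m : ℝ) + 2) := by positivity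
  have hN2 : √((m : ℝ) + 2) ^ 2 = m + 2 := Real.sq_sqrt (by positivity)
  let e : EuclideanSpace ℝ (Fin (m + 2)) := WithLp.toLp 2 fun _ => 1 / √((m : ℝ) + 2)
  let v : Fin (m + 2) → EuclideanSpace ℝ (Fin (m + 2)) :=
    fun i => if i = 0 then WithLp.toLp 2 a else e
  have hv : Orthonormal ℝ (({0, 1} : Set (Fin (m + 2))).domRestrict v) := by
    have ha : inner ℝ (WithLp.toLp 2 a : EuclideanSpace ℝ (Fin (m + 2))) (WithLp.toLp 2 a) = 1 := by
      rw [PiLp.inner_apply, ← ha1]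
      simp [sq]
    have he : inner ℝ e e = 1 := by
      rw [PiLp.inner_apply]
      simp only [e, RCLike.inner_apply, conj_trivial, Finset.sum_const, Finset.card_univ,
        Fintype.card_fin, nsmul_eq_mul]
      push_cast
      rw [← sq, one_div, inv_pow, hN2]
      field_simp
    have hae : inner ℝ (WithLp.toLp 2 a : EuclideanSpace ℝ (Fin (m + 2))) e = 0 := by
      rw [PiLp.inner_apply]
      simp only [e, RCLike.inner_apply, conj_trivial, ← Finset.mul_sum, ha0, mul_zero]
    rw [orthonormal_iff_ite]
    rintro ⟨i, rfl | rfl⟩ ⟨j, rfl | rfl⟩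
    · simpa [v] using ha
    · rw [if_neg fun h => zero_ne_one (congrArg Subtype.val h)]
      simpa [v] using hae
    · rw [if_neg fun h => one_ne_zero (congrArg Subtype.val h)]
      simpa [v, real_inner_comm] using hae
    · simpa [v] using he
  obtain ⟨b, hb⟩ := hv.exists_orthonormalBasis_extension_of_card_eq (by simp)
  have hb0 : ∀ j, b 0 j = a j := fun j => by rw [hb 0 (by simp)]; simp [v]
  have hb1 : ∀ j, b 1 j = 1 / √((m : ℝ) + 2) := fun j => by rw [hb 1 (by simp)]; simp [v, e]
  have h := integral_expWeight_hyperplane ha0 ha1 one_pos (measurePreserving_frameParam b)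
    (fun s p => by
      have h1 : ∀ l : Fin (m + 1), ∑ j, a j * b l.succ j = 0 := fun l => by
        have : inner ℝ (b l.succ) (b 0) = 0 := b.orthonormal.2 (Fin.succ_ne_zero l)
        rw [PiLp.inner_apply] at this
        simpa [hb0] using this
      simp only [Pi.add_apply, Pi.smul_apply, smul_eq_mul, hb0, frameParam_apply, mul_add,
        Finset.sum_add_distrib, Finset.mul_sum]
      rw [Finset.sum_comm]
      have h2 : ∀ l : Fin (m + 1), ∑ j, a j * (p l * b l.succ j) = 0 := fun l => by
        rw [← mul_zero (p l), ← h1 l, Finset.mul_sum]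
        exact Finset.sum_congr rfl fun j _ => by ring
      simp only [h2, Finset.sum_const_zero, add_zero, one_mul]
      have h3 : ∑ j, a j * (s * a j) = s * ∑ j, a j ^ 2 := by
        rw [Finset.mul_sum]
        exact Finset.sum_congr rfl fun j _ => by ring
      rw [h3, ha1, mul_one])
    (fun j => ⟨Pi.single 0 1, by
      rw [frameParam_apply, Finset.sum_eq_single 0 (by intro l _ hl; simp [hl]) (by simp)]
      simp [hb1, hN.ne']⟩)
  rw [integral_expWeight_frameParam hb1] at h
  rw [← h, euclideanHausdorffMeasure_section hb1 (fun x hx => by simpa only [hb0] using hH x hx)]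
  field_simp

/-! ### The facet-parallel section and the conclusion -/

lemma IsFacetHyperplane.exists_normal {n : ℕ}
    {F : AffineSubspace ℝ (EuclideanSpace ℝ (Fin (n + 1)))} (hF : IsFacetHyperplane n F) :
    ∃ (a : Fin (n + 1) → ℝ) (i : Fin (n + 1)), ∑ j, a j = 0 ∧ ∑ j, a j ^ 2 = 1 ∧ 0 ≤ a i ∧
      (∀ j k, j ≠ i → k ≠ i → a j = a k) ∧
      ∀ x : EuclideanSpace ℝ (Fin (n + 1)), ∑ j, x j = 1 → (x ∈ F ↔ ∑ j, a j * x j = 0) := by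
  obtain ⟨hc, i, hi⟩ := hF
  obtain ⟨a, ha0, ha1, ha⟩ := hc.exists_normal
  have heq : ∀ j k, j ≠ i → k ≠ i → a j = a k := by
    intro j k hj hk
    have hmem : ∀ l, l ≠ i → EuclideanSpace.single l (1 : ℝ) ∈ affineSpan ℝ (simplexFacet n i) :=
      fun l hl => subset_affineSpan ℝ _ (subset_convexHull ℝ _ ⟨l, hl, rfl⟩)
    -- The edge vector e_j - e_k of the facet is a direction of F, hence orthogonal to a.
    have hv := hi (AffineSubspace.vsub_mem_direction (hmem j hj) (hmem k hk))
    have hx := AffineSubspace.vadd_mem_of_mem_direction hv hc.center_mem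
    have hsum : ∀ w : Fin (n + 1) → ℝ,
        ∑ l, w l * ((EuclideanSpace.single j (1 : ℝ) -ᵥ EuclideanSpace.single k (1 : ℝ) :
          EuclideanSpace ℝ (Fin (n + 1))) +ᵥ simplexCenter n : EuclideanSpace ℝ (Fin (n + 1))) l =
          w j - w k + (∑ l, w l) * (1 / ((n : ℝ) + 1)) := by
      intro w
      rw [Finset.sum_mul]
      simp only [vsub_eq_sub, vadd_eq_add, PiLp.add_apply, PiLp.sub_apply,
        PiLp.single_apply, simplexCenter_apply, mul_add, mul_sub, Finset.sum_add_distrib,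
        Finset.sum_sub_distrib, mul_ite, mul_one, mul_zero, Finset.sum_ite_eq', Finset.mem_univ,
        if_true]
    have h1 := hsum fun _ => 1
    simp only [one_mul, sub_self, zero_add, Finset.sum_const, Finset.card_univ, Fintype.card_fin,
      nsmul_eq_mul, mul_one] at h1
    have h2 := (ha _ (h1.trans (by push_cast; field_simp))).1 hx
    rw [hsum, ha0, zero_mul, add_zero] at h2
    exact sub_eq_zero.1 h2
  rcases le_total 0 (a i) with h | h
  · exact ⟨a, i, ha0, ha1, h, heq, ha⟩
  · refine ⟨fun j => -a j, i, by simp [ha0], by simpa using ha1, by simpa using h,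
      fun j k hj hk => congrArg Neg.neg (heq j k hj hk), fun x hx => ?_⟩
    rw [ha x hx]
    simp

/-- Sum zero and unit length leave only the normal with i-th entry √((m+1)/(m+2)) and all others
equal. -/
lemma sectionVolume_facet {m : ℕ} {F : AffineSubspace ℝ (EuclideanSpace ℝ (Fin (m + 2)))}
    (hF : IsFacetHyperplane (m + 1) F) :
    sectionVolume (m + 1) F = √((m : ℝ) + 2) / m.factorial *
      (√(((m : ℝ) + 2) / (m + 1)) * (((m : ℝ) + 1) / (m + 2)) ^ (m + 1)) := by
  obtain ⟨a, i, ha0, ha1, hai, heq, ha⟩ := hF.exists_normal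
  have hm : ((m + 1 : ℕ) : ℝ) ≠ 0 := by positivity
  have hβ : ∀ l, a (i.succAbove l) = a (i.succAbove 0) := fun l =>
    heq _ _ (Fin.succAbove_ne i l) (Fin.succAbove_ne i 0)
  have hβ' : a (i.succAbove 0) = -a i / (m + 1 : ℕ) := by
    rw [Fin.sum_univ_succAbove _ i] at ha0
    simp only [hβ, Finset.sum_const, Finset.card_univ, Fintype.card_fin, nsmul_eq_mul] at ha0
    rw [eq_div_iff hm]
    linarith
  have hsq : a i ^ 2 * (((m : ℝ) + 2) / (m + 1)) = 1 := by
    have h := ha1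
    rw [Fin.sum_univ_succAbove _ i] at h
    simp only [hβ, hβ', Finset.sum_const, Finset.card_univ, Fintype.card_fin, nsmul_eq_mul] at h
    push_cast at h
    refine Eq.trans ?_ h
    field_simp
    ring
  have hpos : 0 < a i := lt_of_le_of_ne hai fun h => by
    rw [← h] at hsq
    norm_num at hsq
  have hinv : 1 / a i = √(((m : ℝ) + 2) / (m + 1)) := by
    rw [eq_comm, Real.sqrt_eq_iff_eq_sq (by positivity) (by positivity), one_div, inv_pow]
    exact eq_inv_of_mul_eq_one_right hsq
  rw [sectionVolume_eq ha0 ha1 ha, integral_expMgf_facet (Nat.succ_pos m) i hpos rfl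
    (fun l => (hβ l).trans hβ') ha1, hinv]
  push_cast
  rw [show (m : ℝ) + 1 + 1 = m + 2 by ring]

lemma tendsto_facet_ratio :
    Tendsto (fun n : ℕ =>
        1 / Real.exp 1 * √(((n : ℝ) + 1) / n) * (((n : ℝ) + 1) / n) ^ (n - 1))
      atTop (𝓝 1) := by
  have hratio : Tendsto (fun n : ℕ => 1 + 1 / (n : ℝ)) atTop (𝓝 1) := by
    simpa using tendsto_one_div_atTop_nhds_zero_nat.const_add (1 : ℝ)
  have hpow := Real.tendsto_one_add_div_pow_exp 1
  have hlim : Tendsto (fun n : ℕ =>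
      1 / Real.exp 1 * √(1 + 1 / (n : ℝ)) * ((1 + 1 / (n : ℝ)) ^ n / (1 + 1 / (n : ℝ)))) atTop
      (𝓝 1) := by
    have hsqrt : Tendsto (fun n : ℕ => √(1 + 1 / (n : ℝ))) atTop (𝓝 1) := by
      have := (Real.continuous_sqrt.tendsto 1).comp hratio
      rwa [Real.sqrt_one] at this
    have h := (hsqrt.const_mul (1 / Real.exp 1)).mul (hpow.div hratio one_ne_zero)
    simpa using h
  refine hlim.congr' ?_
  filter_upwards [eventually_gt_atTop 0] with n hn
  obtain ⟨m, rfl⟩ := Nat.exists_eq_succ_of_ne_zero hn.ne'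
  have h1 : 1 + 1 / ((m.succ : ℕ) : ℝ) = ((m.succ : ℕ) + 1 : ℝ) / (m.succ : ℕ) := by
    have : ((m.succ : ℕ) : ℝ) ≠ 0 := by positivity
    field_simp
  have h2 : ((m.succ : ℕ) + 1 : ℝ) / (m.succ : ℕ) ≠ 0 := by positivity
  rw [h1, Nat.succ_sub_one, pow_succ, mul_div_assoc, div_self h2, mul_one]

theorem theorem1p1 :
    (∀ n : ℕ, 2 ≤ n →
      ∀ H F : AffineSubspace ℝ (EuclideanSpace ℝ (Fin (n + 1))),
        IsCentralHyperplane n H → IsFacetHyperplane n F →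
          1 / Real.exp 1 * √(((n : ℝ) + 1) / n) * (((n : ℝ) + 1) / n) ^ (n - 1) *
              sectionVolume n F ≤ sectionVolume n H ∧
          1 / Real.exp 1 * √(((n : ℝ) + 1) / n) * (((n : ℝ) + 1) / n) ^ (n - 1) *
              sectionVolume n F =
            1 / Real.exp 1 * (√((n : ℝ) + 1) / ((n - 1).factorial : ℝ))) ∧
    Tendsto (fun n : ℕ =>
        1 / Real.exp 1 * √(((n : ℝ) + 1) / n) * (((n : ℝ) + 1) / n) ^ (n - 1))
      atTop (𝓝 1) := by

  refine ⟨fun n hn H F hH hF => ?_, tendsto_facet_ratio⟩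
  obtain ⟨m, rfl⟩ : ∃ m, n = m + 1 := ⟨n - 1, by omega⟩
  have hEq : 1 / Real.exp 1 * √((((m + 1 : ℕ) : ℝ) + 1) / (m + 1 : ℕ)) *
      ((((m + 1 : ℕ) : ℝ) + 1) / (m + 1 : ℕ)) ^ (m + 1 - 1) * sectionVolume (m + 1) F =
      1 / Real.exp 1 * (√(((m + 1 : ℕ) : ℝ) + 1) / ((m + 1 - 1).factorial : ℝ)) := by
    rw [sectionVolume_facet hF, Nat.add_sub_cancel]
    push_cast
    rw [show (m : ℝ) + 1 + 1 = m + 2 by ring]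
    have hs : √(((m : ℝ) + 2) / (m + 1)) * √(((m : ℝ) + 2) / (m + 1)) = ((m : ℝ) + 2) / (m + 1) :=
      Real.mul_self_sqrt (by positivity)
    have hp : (((m : ℝ) + 2) / (m + 1)) ^ (m + 1) * (((m : ℝ) + 1) / (m + 2)) ^ (m + 1) = 1 := by
      rw [← mul_pow, div_mul_div_comm, mul_comm, div_self (by positivity), one_pow]
    -- One square root comes from the stated constant and one from the facet volume; their product
    -- supplies the missing power m + 1.
    calc _ = 1 / Real.exp 1 * (√((m : ℝ) + 2) / m.factorial) *
          ((((m : ℝ) + 2) / (m + 1)) ^ m *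
            (√(((m : ℝ) + 2) / (m + 1)) * √(((m : ℝ) + 2) / (m + 1))) *
            (((m : ℝ) + 1) / (m + 2)) ^ (m + 1)) := by ring
      _ = _ := by rw [hs, ← pow_succ, hp, mul_one]
  refine ⟨hEq.le.trans ?_, hEq⟩
  obtain ⟨a, ha0, ha1, ha⟩ := hH.exists_normal
  rw [sectionVolume_eq ha0 ha1 ha, mul_comm, Nat.add_sub_cancel]
  push_cast
  rw [show (m : ℝ) + 1 + 1 = m + 2 by ring]
  exact mul_le_mul_of_nonneg_left (inv_exp_le_integral_expMgf ha0 ha1) (by positivity)
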